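/- Let $K$ be a field and let $f\in K(z)$ be a rational function of degree $d\ge 2$. Let $t$ be transcendental over $K$, fix a separable closure $K(t)^{\mathrm{sep}}$ of $K(t)$, and let $K^{\mathrm{sep}}\subseteq K(t)^{\mathrm{sep}}$ be the field of elements separable algebraic over $K$. Let $T=\bigsqcup_{n\ge 0}f^{-n}(t)$ be the tree of preimages of $t$ in $\mathbb{P}^1(K(t)^{\mathrm{sep}})$, rooted at $t$, where the parent of a vertex $y\in f^{-(n+1)}(t)$ is $f(y)\in f^{-n}(t)$. Let $\mathrm{Aut}\,T$ be its group of rooted-tree automorphisms, and let $G_\infty(K,f,t)$ and $G_\infty(K^{\mathrm{sep}},f,t)$ be the images in $\mathrm{Aut}\,T$ of the Galois groups $\mathrm{Gal}(K(t)^{\mathrm{sep}}/K(t))$ and $\mathrm{Gal}(K(t)^{\mathrm{sep}}/K^{\mathrm{sep}}(t))$ respectively. Similarly, for $\alpha\in K$ let $T_\alpha=\bigsqcup_{n\ge 0}f^{-n}(\alpha)$ be the tree of preimages of $\alpha$ in $\mathbb{P}^1$ over a separable closure of $K$, and let $G_\infty(K,f,\alpha)\le\mathrm{Aut}\,T_\alpha$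 be the image of the absolute Galois group of $K$. Suppose that $\alpha\in K$ is not strictly post-critical, i.e. $\alpha\notin\bigcup_{n\ge 1}f^n(C_f)$, where $C_f\subseteq\mathbb{P}^1(\overline{K})$ is the set of critical points of $f$ (so that $T_\alpha$ and $T$ are both isomorphic to the $d$-adic rooted tree). If $$|\mathrm{Aut}\,T_\alpha:G_\infty(K,f,\alpha)|<\infty,$$ then $$G_\infty(K^{\mathrm{sep}},f,t)=G_\infty(K,f,t)=\mathrm{Aut}\,T.$$ -/

import Mathlib

namespace Arboreal

open Polynomial

universe u v w

section RationalMap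

variable {K : Type u} [Field K]

/-- The degree of a rational function: the maximum of the degrees of its numerator and denominator
in lowest terms. -/
noncomputable def ratDegree (f : RatFunc K) : ℕ :=
  max f.num.natDegree f.denom.natDegree

open Classical in
/-- The map `ℙ¹(L) → ℙ¹(L)` induced by a rational function `f ∈ K(z)`, for a field extension `L`
of `K`, where `ℙ¹(L) = L ∪ {∞}`. Recall that `f.num` and `f.denom` are coprime. -/
noncomputable def ratMap (f : RatFunc K) (L : Type v) [Field L] [Algebra K L] :
    OnePoint L → OnePoint L
  | OnePoint.infty =>
      if f.denom.natDegree < f.num.natDegree then OnePoint.infty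
      else OnePoint.some
        (algebraMap K L (f.num.coeff f.denom.natDegree / f.denom.leadingCoeff))
  | OnePoint.some x =>
      if aeval x f.denom = 0 then OnePoint.infty
      else OnePoint.some (aeval x f.num / aeval x f.denom)

/-- Critical (i.e. ramification) points of `f = p / q` in `ℙ¹(L)`: a finite point is critical if
`p q' - p' q` vanishes there (at points that are not poles this says `f' = 0`, at poles that
`(1 / f)' = 0`); the point `∞` is critical for `f` if `0` is critical for
`f (1 / z) = (z ^ d * p (1 / z)) / (z ^ d * q (1 / z))`, where `d` is the degree of `f`. -/
def IsCriticalPoint (f : RatFunc K) (L : Type v) [Field L] [Algebra K L] : OnePoint L → Prop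
  | OnePoint.infty =>
      aeval (0 : L)
        (wronskian (f.num.reflect (ratDegree f)) (f.denom.reflect (ratDegree f))) = 0
  | OnePoint.some x => aeval x (wronskian f.num f.denom) = 0

/-- `α ∈ K` is strictly post-critical for `f` if it lies in `⋃ n ≥ 1, f ^ n (C_f)`, where `C_f` is
the set of critical points of `f` (over an algebraic closure of `K`). -/
def IsStrictlyPostcritical (f : RatFunc K) (α : K) : Prop :=
  ∃ n : ℕ, 1 ≤ n ∧ ∃ c : OnePoint (AlgebraicClosure K),
    IsCriticalPoint f (AlgebraicClosure K) c ∧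
      (ratMap f (AlgebraicClosure K))^[n] c =
        OnePoint.some (algebraMap K (AlgebraicClosure K) α)

theorem ratMap_map (f : RatFunc K) {L : Type v} [Field L] [Algebra K L] (σ : L ≃ₐ[K] L)
    (y : OnePoint L) :
    ratMap f L (OnePoint.map σ y) = OnePoint.map σ (ratMap f L y) := by
  cases y with
  | infty =>
    simp only [OnePoint.map_infty, ratMap]
    split_ifs
    · rfl
    · rw [OnePoint.map_some, AlgEquiv.commutes]
  | coe x =>
    have h : ∀ p : K[X], aeval (σ x) p = σ (aeval x p) := fun p => aeval_algHom_apply σ x p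
    by_cases hx : aeval x f.denom = 0
    · simp [ratMap, h, hx]
    · simp [ratMap, h, hx]

theorem ratMap_iterate_map (f : RatFunc K) {L : Type v} [Field L] [Algebra K L] (σ : L ≃ₐ[K] L)
    (n : ℕ) (y : OnePoint L) :
    (ratMap f L)^[n] (OnePoint.map σ y) = OnePoint.map σ ((ratMap f L)^[n] y) :=
  Function.Commute.iterate_left (f := ratMap f L) (g := OnePoint.map σ)
    (fun z => ratMap_map f σ z) n y

end RationalMap

section Tree

variable {K : Type u} [Field K] {L : Type v} [Field L] [Algebra K L]

/-- The vertices of the tree of preimages of a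
point `x ∈ L`, the disjoint union
over `n ≥ 0` of the sets `f ^ (-n) (x)` in `ℙ¹(L)`; the first component of a vertex is its level. -/
def PreimageTree (f : RatFunc K) (x : L) : Type v :=
  Σ n : ℕ, {y : OnePoint L // (ratMap f L)^[n] y = OnePoint.some x}

/-- The parent of a vertex `y` at level `n + 1` is the vertex `f y` at level `n`. The root is sent
to itself. -/
noncomputable def PreimageTree.parent {f : RatFunc K} {x : L} :
    PreimageTree f x → PreimageTree f x
  | ⟨0, y⟩ => ⟨0, y⟩
  | ⟨n + 1, y⟩ => ⟨n, ratMap f L y.1, y.2⟩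

/-- The automorphism group of the rooted tree of preimages of `x`: the permutations of the vertices
that preserve the levels and the parent-child relation. -/
def treeAut (f : RatFunc K) (x : L) : Subgroup (Equiv.Perm (PreimageTree f x)) where
  carrier := {g | ∀ v, (g v).1 = v.1 ∧ (g v).parent = g v.parent}
  one_mem' := fun _ => ⟨rfl, rfl⟩
  mul_mem' := by
    intro a b ha hb v
    refine ⟨(ha (b v)).1.trans (hb v).1, ?_⟩
    rw [Equiv.Perm.mul_apply, Equiv.Perm.mul_apply, (ha (b v)).2, (hb v).2]
  inv_mem' := by
    intro a ha v
    have e : a (a⁻¹ v) = v := Equiv.apply_symm_apply a v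
    have h := ha (a⁻¹ v)
    rw [e] at h
    exact ⟨h.1.symm, by rw [h.2]; exact (Equiv.symm_apply_apply a _).symm⟩

end Tree

section Representation

variable {K : Type u} [Field K] (f : RatFunc K) (F : Type w) [Field F] [Algebra K F]
  {L : Type v} [Field L] [Algebra K L] [Algebra F L] [IsScalarTower K F L]

theorem iterate_map_eq {x : L} (hx : x ∈ Set.range (algebraMap F L)) (σ : Gal(L/F)) {n : ℕ}
    {y : OnePoint L} (hy : (ratMap f L)^[n] y = OnePoint.some x) :
    (ratMap f L)^[n] (OnePoint.map σ y) = OnePoint.some x := by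
  have h := ratMap_iterate_map f (σ.restrictScalars K) n y
  obtain ⟨a, rfl⟩ := hx
  refine h.trans ?_
  rw [hy, OnePoint.map_some]
  exact congrArg OnePoint.some (σ.commutes a)

/-- The action of `σ ∈ Gal(L/F)` on the vertices of the tree of preimages of `x ∈ F`. -/
def galMap {x : L} (hx : x ∈ Set.range (algebraMap F L)) (σ : Gal(L/F)) (v : PreimageTree f x) :
    PreimageTree f x :=
  ⟨v.1, OnePoint.map σ v.2.1, iterate_map_eq f F hx σ v.2.2⟩

theorem galMap_one {x : L} (hx : x ∈ Set.range (algebraMap F L)) (v : PreimageTree f x) :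
    galMap f F hx 1 v = v := by
  obtain ⟨n, y, hy⟩ := v
  exact congrArg (Sigma.mk n) (Subtype.ext (congrFun OnePoint.map_id y))

theorem galMap_mul {x : L} (hx : x ∈ Set.range (algebraMap F L)) (σ τ : Gal(L/F))
    (v : PreimageTree f x) : galMap f F hx (σ * τ) v = galMap f F hx σ (galMap f F hx τ v) := by
  obtain ⟨n, y, hy⟩ := v
  exact congrArg (Sigma.mk n) (Subtype.ext (congrFun (OnePoint.map_comp σ τ) y))

theorem galMap_parent {x : L} (hx : x ∈ Set.range (algebraMap F L)) (σ : Gal(L/F))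
    (v : PreimageTree f x) : (galMap f F hx σ v).parent = galMap f F hx σ v.parent := by
  obtain ⟨n, y, hy⟩ := v
  cases n with
  | zero => rfl
  | succ n =>
    exact congrArg (Sigma.mk n) (Subtype.ext (ratMap_map f (σ.restrictScalars K) y))

/-- The arboreal Galois representation `Gal(L/F) → Aut T`, where `T` is the tree of preimages in
`ℙ¹(L)` of a point `x` of `F` (seen in `L`) under `f ∈ K(z)`, with `K ⊆ F ⊆ L`. -/
def arborealRep {x : L} (hx : x ∈ Set.range (algebraMap F L)) : Gal(L/F) →* treeAut f x where
  toFun σ :=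
    ⟨{ toFun := galMap f F hx σ
       invFun := galMap f F hx σ⁻¹
       left_inv := fun v => by rw [← galMap_mul, inv_mul_cancel, galMap_one]
       right_inv := fun v => by rw [← galMap_mul, mul_inv_cancel, galMap_one] },
      fun v => ⟨rfl, galMap_parent f F hx σ v⟩⟩
  map_one' := Subtype.ext (Equiv.ext (galMap_one f F hx))
  map_mul' σ τ := Subtype.ext (Equiv.ext (galMap_mul f F hx σ τ))

end Representation

section Groups

variable {K : Type u} [Field K] (f : RatFunc K)

/-- The specialization `G_∞(K, f, α)`: the image of `Gal(K^sep/K)` in the automorphism group of the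
tree of preimages of `α ∈ K`, where `Ksep` is a separable closure of `K`. -/
noncomputable def specializationGroup (Ksep : Type v) [Field Ksep] [Algebra K Ksep] (α : K) :
    Subgroup (treeAut f (algebraMap K Ksep α)) :=
  (arborealRep f K (Set.mem_range_self α)).range

variable (Ω : Type v) [Field Ω] [Algebra (RatFunc K) Ω] [Algebra K Ω]
  [IsScalarTower K (RatFunc K) Ω]

/-- The transcendental element `t` of `K(t)`, as an element of an extension `Ω` of `K(t)`. -/
noncomputable def genericPoint : Ω :=
  algebraMap (RatFunc K) Ω RatFunc.X

/-- The arithmetic iterated Galois group `G_∞(K, f, t)`: the image of `Gal(Ω/K(t))` in the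
automorphism group of the tree of preimages of `t`, where `Ω` is a separable closure of `K(t)`. -/
noncomputable def arithmeticGroup : Subgroup (treeAut f (genericPoint (K := K) Ω)) :=
  (arborealRep f (RatFunc K) (Set.mem_range_self RatFunc.X)).range

/-- The field `K^sep(t)` inside a separable closure `Ω` of `K(t)`, where `K^sep` is the field of all
elements of `Ω` that are separable algebraic over `K`. -/
noncomputable def geometricField (K : Type u) [Field K] (Ω : Type v) [Field Ω]
    [Algebra (RatFunc K) Ω] [Algebra K Ω] : IntermediateField (RatFunc K) Ω :=
  IntermediateField.adjoin (RatFunc K) (separableClosure K Ω : Set Ω)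

instance geometricField_isScalarTower (K : Type u) [Field K] (Ω : Type v) [Field Ω]
    [Algebra (RatFunc K) Ω] [Algebra K Ω] [IsScalarTower K (RatFunc K) Ω] :
    IsScalarTower K (geometricField K Ω) Ω :=
  IsScalarTower.of_algebraMap_eq fun _ => rfl

/-- The geometric iterated Galois group `G_∞(K^sep, f, t)`: the image of `Gal(Ω/K^sep(t))` in the
automorphism group of the tree of preimages of `t`. Here `Ω`, a separable closure of `K(t)`, is also
one of `K^sep(t)`. -/
noncomputable def geometricGroup : Subgroup (treeAut f (genericPoint (K := K) Ω)) :=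
  (arborealRep f (geometricField K Ω)
    (Set.mem_range_self (algebraMap (RatFunc K) (geometricField K Ω) RatFunc.X))).range

end Groups

end Arboreal

/-! Specialization shows that the arithmetic group has finite index, and self-similarity turns
finite index into equality, even for the geometric group.

Specialization (`finiteIndex_arithmeticGroup`). Put `t = α + X` in the field `L` of Laurent series
over `K^sep`. No vertex of positive level in the tree of `α` is critical, so by Hensel's lemma every
such vertex lifts; since fibers have at most `d` points, reduction modulo `X` is an isomorphism from
the tree of `α + X` over `L` onto the tree of `α`. An embedding of `K(t)^sep` in an algebraic
closure of `L` identifies the former tree with `T`. A Galois automorphism of `K^sep` acts on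
coefficients, fixes `α + X`, extends to the algebraic closure and restricts to `K(t)^sep`, with the
same action on the trees. So the group of `α` embeds in that of `t`, compatibly with the isomorphism
of automorphism groups.

Self-similarity (`exists_genericRep_eq_of_isSection`). A child `a` of `t` is transcendental over
`K`, and `K(t)^sep` is also a separable closure of `K^sep(a)`; hence some automorphism `φ` over
`K^sep` sends `t` to `a`. If `σ` fixes `a`, then `φ⁻¹ σ φ` fixes `t`, acts on `T` as `σ` acts above
`a`, and agrees with `σ` on `K^sep`. So the arithmetic group contains its own sections at `a`. A
pigeonhole argument on cosets (`eq_top_of_finiteIndex_of_isSection`) then makes it everything.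

For the geometric group, take `σ` acting as `τ` above one child and trivially above another. Its two
sections agree with `σ` on `K^sep`, so their quotient fixes `K^sep` and acts as `τ`. -/

namespace Arboreal

open Polynomial

/-! ### Homogeneous coordinates, and the fibers of a rational map. -/

section ProjectiveLine

universe u v w

/-- The value at `(x, y)` of the homogenization of degree `d` of a polynomial `p` of degree at most
`d`. -/
noncomputable def homogEval {K : Type u} [Field K] {R : Type v} [CommRing R] [Algebra K R] (d : ℕ)
    (p : K[X]) (x y : R) : R :=
  ∑ i ∈ Finset.range (d + 1), algebraMap K R (p.coeff i) * x ^ i * y ^ (d - i)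

open Classical in
/-- The point of `ℙ¹(L) = L ∪ {∞}` with homogeneous coordinates `x` and `y`. -/
noncomputable def homogPoint {L : Type v} [Field L] (x y : L) : OnePoint L :=
  if y = 0 then OnePoint.infty else OnePoint.some (x / y)

variable {K : Type u} [Field K]

theorem map_homogEval {R : Type v} [CommRing R] [Algebra K R] {S : Type w} [CommRing S]
    [Algebra K S] (φ : R →ₐ[K] S) (d : ℕ) (p : K[X]) (x y : R) :
    φ (homogEval d p x y) = homogEval d p (φ x) (φ y) := by
  simp [homogEval, map_sum]

theorem homogEval_one_right {R : Type v} [CommRing R] [Algebra K R] {d : ℕ} {p : K[X]}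
    (hp : p.natDegree ≤ d) (x : R) : homogEval d p x 1 = aeval x p := by
  rw [aeval_eq_sum_range' (Nat.lt_succ_of_le hp)]
  simp [homogEval, Algebra.smul_def]

theorem homogEval_one_left {R : Type v} [CommRing R] [Algebra K R] {d : ℕ} {p : K[X]}
    (hp : p.natDegree ≤ d) (y : R) : homogEval d p 1 y = aeval y (p.reflect d) := by
  have h : (p.reflect d).natDegree ≤ d := natDegree_reflect_le.trans (by simp [hp])
  rw [aeval_eq_sum_range' (Nat.lt_succ_of_le h), ← Finset.sum_range_reflect, homogEval]
  refine Finset.sum_congr rfl fun i hi => ?_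
  have hi' : i ≤ d := Nat.lt_succ_iff.1 (Finset.mem_range.1 hi)
  have e : d + 1 - 1 - i = d - i := by omega
  rw [e, coeff_reflect, revAt_le (Nat.sub_le d i), Nat.sub_sub_self hi', Algebra.smul_def, one_pow,
    mul_one]

theorem homogEval_smul {R : Type v} [CommRing R] [Algebra K R] (d : ℕ) (p : K[X]) (c x y : R) :
    homogEval d p (c * x) (c * y) = c ^ d * homogEval d p x y := by
  simp only [homogEval, Finset.mul_sum]
  refine Finset.sum_congr rfl fun i hi => ?_
  have hi' : i ≤ d := Nat.lt_succ_iff.1 (Finset.mem_range.1 hi)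
  rw [mul_pow, mul_pow]
  calc _ = algebraMap K R (p.coeff i) * (c ^ i * c ^ (d - i)) * x ^ i * y ^ (d - i) := by ring
    _ = _ := by rw [← pow_add, Nat.add_sub_cancel' hi']; ring

theorem homogEval_one_zero {R : Type v} [CommRing R] [Algebra K R] {d : ℕ} {p : K[X]}
    (hp : p.natDegree ≤ d) : homogEval d p (1 : R) 0 = algebraMap K R (p.coeff d) := by
  rw [homogEval_one_left hp, ← coeff_zero_eq_aeval_zero', coeff_reflect, revAt_zero]

section Points

variable {L : Type v} [Field L]

@[simp] theorem homogPoint_zero_right (x : L) : homogPoint x 0 = OnePoint.infty := by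
  simp [homogPoint]

@[simp] theorem homogPoint_one_right (x : L) : homogPoint x 1 = OnePoint.some x := by
  simp [homogPoint]

theorem homogPoint_of_ne_zero (x : L) {y : L} (hy : y ≠ 0) :
    homogPoint x y = OnePoint.some (x / y) := by
  simp [homogPoint, hy]

theorem homogPoint_smul {c : L} (hc : c ≠ 0) (x y : L) :
    homogPoint (c * x) (c * y) = homogPoint x y := by
  by_cases hy : y = 0
  · simp [hy]
  · rw [homogPoint_of_ne_zero _ (mul_ne_zero hc hy), homogPoint_of_ne_zero _ hy,
      mul_div_mul_left _ _ hc]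

theorem homogPoint_eq_iff {x y a b : L} (hxy : x ≠ 0 ∨ y ≠ 0) (hab : a ≠ 0 ∨ b ≠ 0) :
    homogPoint x y = homogPoint a b ↔ b * x = a * y := by
  by_cases hy : y = 0
  · subst hy
    have hx : x ≠ 0 := by simpa using hxy
    by_cases hb : b = 0
    · simp [hb]
    · rw [homogPoint_of_ne_zero _ hb, homogPoint_zero_right]
      simp [hb, hx, OnePoint.infty_ne_coe]
  · by_cases hb : b = 0
    · subst hb
      have ha : a ≠ 0 := by simpa using hab
      rw [homogPoint_of_ne_zero _ hy, homogPoint_zero_right]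
      simp [ha, hy, OnePoint.coe_ne_infty]
    · rw [homogPoint_of_ne_zero _ hy, homogPoint_of_ne_zero _ hb, OnePoint.coe_eq_coe,
        div_eq_div_iff hy hb, mul_comm x b]

theorem exists_homogPoint_eq (z : OnePoint L) :
    ∃ x y : L, (x ≠ 0 ∨ y ≠ 0) ∧ homogPoint x y = z := by
  cases z with
  | infty => exact ⟨1, 0, by simp, by simp⟩
  | coe z => exact ⟨z, 1, by simp, by simp⟩

theorem map_homogPoint {L' : Type w} [Field L'] (φ : L →+* L') (x y : L) :
    OnePoint.map φ (homogPoint x y) = homogPoint (φ x) (φ y) := by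
  by_cases hy : y = 0
  · simp [hy]
  · have hy' : φ y ≠ 0 := (_root_.map_ne_zero φ).2 hy
    rw [homogPoint_of_ne_zero _ hy, homogPoint_of_ne_zero _ hy', OnePoint.map_some, map_div₀]

theorem onePoint_map_injective {X : Type v} {Y : Type w} {φ : X → Y} (hφ : Function.Injective φ) :
    Function.Injective (OnePoint.map φ) :=
  Option.map_injective hφ

end Points

section RatMap

variable (f : RatFunc K)

theorem natDegree_num_le_ratDegree : f.num.natDegree ≤ ratDegree f := le_max_left _ _

theorem natDegree_denom_le_ratDegree : f.denom.natDegree ≤ ratDegree f := le_max_right _ _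

variable {L : Type v} [Field L] [Algebra K L]

/-- At finite points this is coprimality of numerator and denominator; at `∞` one of the two attains
the degree `d`, so its top coefficient survives. -/
theorem homogEval_ne_zero {x y : L} (hxy : x ≠ 0 ∨ y ≠ 0) :
    homogEval (ratDegree f) f.num x y ≠ 0 ∨ homogEval (ratDegree f) f.denom x y ≠ 0 := by
  have hp := natDegree_num_le_ratDegree f
  have hq := natDegree_denom_le_ratDegree f
  by_cases hy : y = 0
  · subst hy
    have hx : x ≠ 0 := by simpa using hxy
    have e : ∀ p : K[X], homogEval (ratDegree f) p x 0 =
        x ^ ratDegree f * homogEval (ratDegree f) p 1 0 := fun p => by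
      rw [← homogEval_smul]; simp
    rw [e, e, homogEval_one_zero hp, homogEval_one_zero hq]
    have hxd : x ^ ratDegree f ≠ 0 := pow_ne_zero _ hx
    rcases le_total f.num.natDegree f.denom.natDegree with h | h
    · right
      have hd : ratDegree f = f.denom.natDegree := max_eq_right h
      refine mul_ne_zero hxd ((_root_.map_ne_zero _).2 ?_)
      rw [hd]
      exact leadingCoeff_ne_zero.2 f.denom_ne_zero
    · by_cases hn : f.num = 0
      · right
        have hd : ratDegree f = f.denom.natDegree := max_eq_right (by simp [hn])
        refine mul_ne_zero hxd ((_root_.map_ne_zero _).2 ?_)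
        rw [hd]
        exact leadingCoeff_ne_zero.2 f.denom_ne_zero
      · left
        have hd : ratDegree f = f.num.natDegree := max_eq_left h
        refine mul_ne_zero hxd ((_root_.map_ne_zero _).2 ?_)
        rw [hd]
        exact leadingCoeff_ne_zero.2 hn
  · have e : ∀ p : K[X], homogEval (ratDegree f) p x y =
        y ^ ratDegree f * homogEval (ratDegree f) p (x / y) 1 := fun p => by
      rw [← homogEval_smul, mul_div_cancel₀ _ hy, mul_one]
    have hyd : y ^ ratDegree f ≠ 0 := pow_ne_zero _ hy
    rw [e, e, homogEval_one_right hp, homogEval_one_right hq]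
    rcases aeval_ne_zero_of_isCoprime f.isCoprime_num_denom (x / y) with h | h
    · exact Or.inl (mul_ne_zero hyd h)
    · exact Or.inr (mul_ne_zero hyd h)

/-- Replaces the case distinctions in `ratMap` by a single formula, which makes compatibility with
field embeddings and with reduction formal. -/
theorem ratMap_homogPoint {x y : L} (hxy : x ≠ 0 ∨ y ≠ 0) :
    ratMap f L (homogPoint x y) =
      homogPoint (homogEval (ratDegree f) f.num x y) (homogEval (ratDegree f) f.denom x y) := by
  have hp := natDegree_num_le_ratDegree f
  have hq := natDegree_denom_le_ratDegree f
  by_cases hy : y = 0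
  · subst hy
    have hx : x ≠ 0 := by simpa using hxy
    have e : ∀ p : K[X], homogEval (ratDegree f) p x 0 =
        x ^ ratDegree f * homogEval (ratDegree f) p 1 0 := fun p => by
      rw [← homogEval_smul]; simp
    rw [e, e, homogPoint_smul (pow_ne_zero _ hx), homogEval_one_zero hp, homogEval_one_zero hq,
      homogPoint_zero_right]
    change (if f.denom.natDegree < f.num.natDegree then OnePoint.infty else OnePoint.some
      (algebraMap K L (f.num.coeff f.denom.natDegree / f.denom.leadingCoeff))) = _
    split_ifs with h
    · have h0 : f.denom.coeff (ratDegree f) = 0 :=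
        coeff_eq_zero_of_natDegree_lt (lt_max_of_lt_left h)
      rw [h0, map_zero, homogPoint_zero_right]
    · have hd : ratDegree f = f.denom.natDegree := max_eq_right (not_lt.1 h)
      have h0 : f.denom.leadingCoeff ≠ 0 := leadingCoeff_ne_zero.2 f.denom_ne_zero
      rw [hd, coeff_natDegree, homogPoint_of_ne_zero _ ((_root_.map_ne_zero _).2 h0), map_div₀]
  · have e : ∀ p : K[X], homogEval (ratDegree f) p x y =
        y ^ ratDegree f * homogEval (ratDegree f) p (x / y) 1 := fun p => by
      rw [← homogEval_smul, mul_div_cancel₀ _ hy, mul_one]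
    rw [e, e, homogPoint_smul (pow_ne_zero _ hy), homogEval_one_right hp, homogEval_one_right hq,
      homogPoint_of_ne_zero _ hy]
    rfl

theorem ratMap_homogPoint_eq_iff {x y a b : L} (hxy : x ≠ 0 ∨ y ≠ 0) (hab : a ≠ 0 ∨ b ≠ 0) :
    ratMap f L (homogPoint x y) = homogPoint a b ↔
      b * homogEval (ratDegree f) f.num x y = a * homogEval (ratDegree f) f.denom x y := by
  rw [ratMap_homogPoint f hxy, homogPoint_eq_iff (homogEval_ne_zero f hxy) hab]

theorem ratMap_algHom {L' : Type w} [Field L'] [Algebra K L'] (φ : L →ₐ[K] L') (z : OnePoint L) :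
    ratMap f L' (OnePoint.map φ z) = OnePoint.map φ (ratMap f L z) := by
  obtain ⟨x, y, hxy, rfl⟩ := exists_homogPoint_eq z
  have hxy' : φ x ≠ 0 ∨ φ y ≠ 0 := by simpa using hxy
  have e : ∀ a b : L, OnePoint.map φ (homogPoint a b) = homogPoint (φ a) (φ b) :=
    map_homogPoint φ.toRingHom
  rw [ratMap_homogPoint f hxy, e, e, ratMap_homogPoint f hxy', map_homogEval, map_homogEval]

theorem isCriticalPoint_algHom {L' : Type w} [Field L'] [Algebra K L'] (φ : L →ₐ[K] L')
    {z : OnePoint L} (hz : IsCriticalPoint f L z) : IsCriticalPoint f L' (OnePoint.map φ z) := by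
  cases z with
  | infty =>
    have h := congrArg φ (show aeval (0 : L) _ = 0 from hz)
    rwa [← aeval_algHom_apply, map_zero] at h
  | coe x =>
    have h := congrArg φ (show aeval x _ = 0 from hz)
    rwa [← aeval_algHom_apply, map_zero] at h

end RatMap

section Fibers

variable (f : RatFunc K) {E : Type v} [Field E] [Algebra K E]

/-- The polynomial `b p - a q`, whose roots are the finite points of the fiber of `f = p / q` over
the point with homogeneous coordinates `a` and `b`. -/
noncomputable def fiberPoly (a b : E) : E[X] :=
  C b * f.num.map (algebraMap K E) - C a * f.denom.map (algebraMap K E)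

theorem natDegree_fiberPoly_le (a b : E) : (fiberPoly f a b).natDegree ≤ ratDegree f := by
  refine (natDegree_sub_le _ _).trans (max_le ?_ ?_)
  · exact (natDegree_C_mul_le _ _).trans
      (natDegree_map_le.trans (natDegree_num_le_ratDegree f))
  · exact (natDegree_C_mul_le _ _).trans
      (natDegree_map_le.trans (natDegree_denom_le_ratDegree f))

theorem coeff_fiberPoly (a b : E) (i : ℕ) : (fiberPoly f a b).coeff i =
    b * algebraMap K E (f.num.coeff i) - a * algebraMap K E (f.denom.coeff i) := by
  simp [fiberPoly]

theorem ratMap_some_eq_iff {a b : E} (hab : a ≠ 0 ∨ b ≠ 0) (z : E) :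
    ratMap f E (OnePoint.some z) = homogPoint a b ↔ (fiberPoly f a b).eval z = 0 := by
  rw [← homogPoint_one_right, ratMap_homogPoint_eq_iff f (by simp) hab,
    homogEval_one_right (natDegree_num_le_ratDegree f),
    homogEval_one_right (natDegree_denom_le_ratDegree f), ← sub_eq_zero]
  simp [fiberPoly, aeval_def, eval_map]

theorem ratMap_infty_eq_iff {a b : E} (hab : a ≠ 0 ∨ b ≠ 0) :
    ratMap f E OnePoint.infty = homogPoint a b ↔ (fiberPoly f a b).coeff (ratDegree f) = 0 := by
  rw [← homogPoint_zero_right 1, ratMap_homogPoint_eq_iff f (by simp) hab,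
    homogEval_one_zero (natDegree_num_le_ratDegree f),
    homogEval_one_zero (natDegree_denom_le_ratDegree f), ← sub_eq_zero, coeff_fiberPoly]

/-- A relation `b p = a q` between coprime polynomials, with `(a, b)` nonzero, forces both to be
constant. -/
theorem fiberPoly_ne_zero (hd : 1 ≤ ratDegree f) {a b : E} (hab : a ≠ 0 ∨ b ≠ 0) :
    fiberPoly f a b ≠ 0 := by
  intro h
  have hcop : IsCoprime (f.num.map (algebraMap K E)) (f.denom.map (algebraMap K E)) :=
    f.isCoprime_num_denom.map (mapRingHom (algebraMap K E))
  have h' : C b * f.num.map (algebraMap K E) = C a * f.denom.map (algebraMap K E) :=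
    sub_eq_zero.1 h
  have key : ∀ p q : E[X], IsCoprime p q → ∀ {r s : E}, r ≠ 0 → C r * p = C s * q →
      p.natDegree = 0 ∧ q.natDegree = 0 := by
    intro p q hpq r s hr e
    have hdvd : q ∣ p := by
      have : C r⁻¹ * (C r * p) = C r⁻¹ * (C s * q) := by rw [e]
      rw [← mul_assoc, ← C_mul, inv_mul_cancel₀ hr, C_1, one_mul] at this
      exact this ▸ (dvd_mul_left q _).mul_left _
    have hq : IsUnit q := hpq.isUnit_of_dvd' hdvd dvd_rfl
    refine ⟨?_, natDegree_eq_zero_of_isUnit hq⟩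
    have : (C r * p).natDegree ≤ 0 := by
      rw [e]
      exact (natDegree_C_mul_le _ _).trans (natDegree_eq_zero_of_isUnit hq).le
    rwa [natDegree_C_mul hr, Nat.le_zero] at this
  have : f.num.natDegree = 0 ∧ f.denom.natDegree = 0 := by
    rw [← natDegree_map (algebraMap K E) (p := f.num),
      ← natDegree_map (algebraMap K E) (p := f.denom)]
    rcases hab with ha | hb
    · exact (key _ _ hcop.symm ha h'.symm).symm
    · exact key _ _ hcop hb h'
  rw [ratDegree, this.1, this.2] at hd
  omega

/-- The point `∞` lies in the fiber exactly when the degree of `b p - a q` drops below `d`; this is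
what makes the point counts below come out right. -/
theorem fiber_homogPoint_eq {a b : E} (hab : a ≠ 0 ∨ b ≠ 0) (hd : 1 ≤ ratDegree f) :
    {z | ratMap f E z = homogPoint a b} =
      OnePoint.some '' ((fiberPoly f a b).rootSet E) ∪
        {z | z = OnePoint.infty ∧ (fiberPoly f a b).coeff (ratDegree f) = 0} := by
  have h0 := fiberPoly_ne_zero f hd hab
  ext z
  cases z with
  | infty => simp [ratMap_infty_eq_iff f hab, OnePoint.coe_ne_infty]
  | coe z => simp [ratMap_some_eq_iff f hab, mem_rootSet, h0, OnePoint.coe_ne_infty]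

theorem fiber_finite (hd : 1 ≤ ratDegree f) (u : OnePoint E) : {z | ratMap f E z = u}.Finite := by
  obtain ⟨a, b, hab, rfl⟩ := exists_homogPoint_eq u
  rw [fiber_homogPoint_eq f hab hd]
  exact ((rootSet_finite _ _).image _).union ((Set.finite_singleton OnePoint.infty).subset
    fun z hz => hz.1)

theorem fiber_ncard_le (hd : 1 ≤ ratDegree f) (u : OnePoint E) :
    {z | ratMap f E z = u}.ncard ≤ ratDegree f := by
  obtain ⟨a, b, hab, rfl⟩ := exists_homogPoint_eq u
  rw [fiber_homogPoint_eq f hab hd]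
  refine (Set.ncard_union_le _ _).trans ?_
  rw [Set.ncard_image_of_injective _ OnePoint.coe_injective]
  have h1 := ncard_rootSet_le (fiberPoly f a b) E
  have h2 := natDegree_fiberPoly_le f a b
  by_cases hc : (fiberPoly f a b).coeff (ratDegree f) = 0
  · have h3 : (fiberPoly f a b).natDegree ≠ ratDegree f := fun h => by
      rw [← h, coeff_natDegree, leadingCoeff_eq_zero] at hc
      exact fiberPoly_ne_zero f hd hab hc
    have : {z : OnePoint E | z = OnePoint.infty ∧
        (fiberPoly f a b).coeff (ratDegree f) = 0}.ncard = 1 := by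
      simp only [hc, and_true, Set.ofPred_eq_eq_singleton, Set.ncard_singleton]
    omega
  · simp only [hc, and_false, Set.ofPred_false, Set.ncard_empty]
    omega

/-- The Wronskian at `∞` is the determinant of the coefficients of `p` and `q` in degrees `d` and `d
- 1`; the nonzero vector `(b, -a)` is in the kernel of that matrix. -/
theorem isCriticalPoint_infty_of_coeff {a b : E} (hab : a ≠ 0 ∨ b ≠ 0) (hd : 1 ≤ ratDegree f)
    (h0 : (fiberPoly f a b).coeff (ratDegree f) = 0)
    (h1 : (fiberPoly f a b).coeff (ratDegree f - 1) = 0) :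
    IsCriticalPoint f E OnePoint.infty := by
  rw [coeff_fiberPoly, sub_eq_zero] at h0 h1
  change aeval (0 : E) (wronskian (f.num.reflect (ratDegree f)) (f.denom.reflect (ratDegree f))) = 0
  simp only [wronskian, map_sub, map_mul, ← coeff_zero_eq_aeval_zero', coeff_derivative,
    coeff_reflect, revAt_zero, zero_add, revAt_le hd]
  simp only [Nat.cast_zero, zero_add, mul_one, map_one]
  rcases hab with ha | hb
  · refine (mul_eq_zero_iff_left ha).1 ?_
    linear_combination (algebraMap K E (f.num.coeff (ratDegree f - 1))) * h0 -
      (algebraMap K E (f.num.coeff (ratDegree f))) * h1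
  · refine (mul_eq_zero_iff_left hb).1 ?_
    linear_combination (algebraMap K E (f.denom.coeff (ratDegree f - 1))) * h0 -
      (algebraMap K E (f.denom.coeff (ratDegree f))) * h1

/-- The same determinant argument: `(b, -a)` kills the values at `z` of both `(p, q)` and `(p',
q')`. -/
theorem isCriticalPoint_of_aeval_eq_zero {a b : E} (hab : a ≠ 0 ∨ b ≠ 0) {M : Type w} [Field M]
    [Algebra K M] [Algebra E M] [IsScalarTower K E M] {z : M}
    (h0 : aeval z (fiberPoly f a b) = 0) (h1 : aeval z (derivative (fiberPoly f a b)) = 0) :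
    IsCriticalPoint f M (OnePoint.some z) := by
  change aeval z (wronskian f.num f.denom) = 0
  simp only [fiberPoly, derivative_C_mul, derivative_map, map_sub, map_mul, aeval_C,
    aeval_map_algebraMap] at h0 h1
  simp only [wronskian, map_sub, map_mul]
  rcases hab with ha | hb
  · refine (mul_eq_zero_iff_left ((_root_.map_ne_zero (algebraMap E M)).2 ha)).1 ?_
    linear_combination (aeval z (derivative f.num)) * h0 - (aeval z f.num) * h1
  · refine (mul_eq_zero_iff_left ((_root_.map_ne_zero (algebraMap E M)).2 hb)).1 ?_
    linear_combination (aeval z (derivative f.denom)) * h0 - (aeval z f.denom) * h1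

theorem separable_fiberPoly {a b : E} (hab : a ≠ 0 ∨ b ≠ 0) (M : Type w) [Field M] [IsAlgClosed M]
    [Algebra K M] [Algebra E M] [IsScalarTower K E M]
    (h : ∀ z : M, ratMap f M (OnePoint.some z) = OnePoint.map (algebraMap E M) (homogPoint a b) →
      ¬ IsCriticalPoint f M (OnePoint.some z)) : (fiberPoly f a b).Separable := by
  refine (isCoprime_iff_aeval_ne_zero_of_isAlgClosed E M _ _).2 fun z => ?_
  by_contra! hz
  refine h z ?_ (isCriticalPoint_of_aeval_eq_zero f hab hz.1 hz.2)
  have hab' : algebraMap E M a ≠ 0 ∨ algebraMap E M b ≠ 0 := by simpa using hab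
  rw [map_homogPoint, ratMap_some_eq_iff f hab']
  simpa [fiberPoly, aeval_map_algebraMap, eval_map_algebraMap] using hz.1

/-- Without critical points in the fiber, `b p - a q` is separable and so splits over `E`. Critical
points are tested over the algebraically closed `M`, since an inseparable polynomial may have no
root in `E`. -/
theorem fiber_ncard_eq [IsSepClosed E] (hd : 1 ≤ ratDegree f) (M : Type w) [Field M]
    [IsAlgClosed M] [Algebra K M] [Algebra E M] [IsScalarTower K E M] {u : OnePoint E}
    (h : ∀ c : OnePoint M, ratMap f M c = OnePoint.map (algebraMap E M) u →
      ¬ IsCriticalPoint f M c) :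
    {z | ratMap f E z = u}.ncard = ratDegree f := by
  obtain ⟨a, b, hab, rfl⟩ := exists_homogPoint_eq u
  have hsep := separable_fiberPoly f hab M fun z hz => h _ hz
  have h0 := fiberPoly_ne_zero f hd hab
  have hcard : ((fiberPoly f a b).rootSet E).ncard = (fiberPoly f a b).natDegree := by
    rw [Set.ncard_eq_toFinset_card', Set.toFinset_card]
    exact card_rootSet_eq_natDegree hsep
      (by simpa using IsSepClosed.splits_of_separable _ hsep)
  have hdisj : Disjoint (OnePoint.some '' ((fiberPoly f a b).rootSet E))
        {z | z = OnePoint.infty ∧ (fiberPoly f a b).coeff (ratDegree f) = 0} := by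
    rw [Set.disjoint_left]
    rintro _ ⟨z, -, rfl⟩ ⟨hz, -⟩
    exact OnePoint.coe_ne_infty z hz
  rw [fiber_homogPoint_eq f hab hd, Set.ncard_union_eq hdisj ((rootSet_finite _ _).image _)
    ((Set.finite_singleton OnePoint.infty).subset fun z hz => hz.1),
    Set.ncard_image_of_injective _ OnePoint.coe_injective, hcard]
  have h2 := natDegree_fiberPoly_le f a b
  by_cases hc : (fiberPoly f a b).coeff (ratDegree f) = 0
  · have h3 : (fiberPoly f a b).natDegree ≠ ratDegree f := fun h => by
      rw [← h, coeff_natDegree, leadingCoeff_eq_zero] at hc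
      exact h0 hc
    -- As `∞` is in the fiber but not critical, the degree drops by exactly one, and `∞` makes up
    -- for the missing root.
    have h4 : (fiberPoly f a b).coeff (ratDegree f - 1) ≠ 0 := fun h4 => by
      refine h OnePoint.infty ?_ ?_
      · have := (ratMap_infty_eq_iff f hab).2 hc
        rw [← this]
        exact ratMap_algHom f (IsScalarTower.toAlgHom K E M) OnePoint.infty
      · exact isCriticalPoint_algHom f (IsScalarTower.toAlgHom K E M)
          (isCriticalPoint_infty_of_coeff f hab hd hc h4)
    have h5 := le_natDegree_of_ne_zero h4
    have : {z : OnePoint E | z = OnePoint.infty ∧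
        (fiberPoly f a b).coeff (ratDegree f) = 0}.ncard = 1 := by
      simp only [hc, and_true, Set.ofPred_eq_eq_singleton, Set.ncard_singleton]
    omega
  · simp only [hc, and_false, Set.ofPred_false, Set.ncard_empty]
    have := le_natDegree_of_ne_zero hc
    omega

end Fibers

end ProjectiveLine

/-! ### Isomorphisms between trees of preimages, and transfer of finite index. -/

section Transfer

universe u v w

/-- Bijectivity on each fiber of one step propagates up the tree, level by level. -/
theorem bijOn_iterate_fiber {X : Type v} {Y : Type w} {F : X → X} {F' : Y → Y} {h : X → Y}
    (hc : Function.Semiconj h F F') {x : X}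
    (hfib : ∀ n v, F^[n] v = x → Set.BijOn h {z | F z = v} {z | F' z = h v}) (n : ℕ) :
    Set.BijOn h {z | F^[n] z = x} {z | F'^[n] z = h x} := by
  induction n with
  | zero =>
    refine ⟨fun z hz => congrArg h hz, fun y hy z hz _ => hy.trans hz.symm, fun z hz => ?_⟩
    exact ⟨x, rfl, hz.symm⟩
  | succ n ih =>
    refine ⟨fun z hz => ?_, fun y hy z hz hyz => ?_, fun z hz => ?_⟩
    · exact ((hc.iterate_right (n + 1)).eq z).symm.trans (congrArg h hz)
    · have e : F y = F z := ih.injOn hy hz (by rw [hc.eq, hc.eq, hyz])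
      exact (hfib n (F z) hz).injOn e rfl hyz
    · obtain ⟨v, hv, hvz⟩ := ih.surjOn (show F' z ∈ {z | F'^[n] z = h x} from hz)
      obtain ⟨y, hy, hyz⟩ := (hfib n v hv).surjOn (show z ∈ {z | F' z = h v} from hvz.symm)
      refine ⟨y, ?_, hyz⟩
      change F^[n] (F y) = x
      rw [show F y = v from hy]
      exact hv

variable {K : Type u} [Field K] {f : RatFunc K} {L : Type v} [Field L] [Algebra K L]
  {L' : Type w} [Field L'] [Algebra K L'] {x : L} {x' : L'}

/-- The isomorphism of trees of preimages induced by a map `ℙ¹(L) → ℙ¹(L')` that commutes with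
`f`. -/
noncomputable def PreimageTree.equiv (h : OnePoint L → OnePoint L')
    (hb : ∀ n, Set.BijOn h {z | (ratMap f L)^[n] z = OnePoint.some x}
      {z | (ratMap f L')^[n] z = OnePoint.some x'}) : PreimageTree f x ≃ PreimageTree f x' :=
  Equiv.sigmaCongrRight fun n => (hb n).equiv

theorem PreimageTree.equiv_parent (h : OnePoint L → OnePoint L')
    (hc : Function.Semiconj h (ratMap f L) (ratMap f L'))
    (hb : ∀ n, Set.BijOn h {z | (ratMap f L)^[n] z = OnePoint.some x}
      {z | (ratMap f L')^[n] z = OnePoint.some x'}) (v : PreimageTree f x) :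
    (PreimageTree.equiv h hb v).parent = PreimageTree.equiv h hb v.parent := by
  obtain ⟨n, y, hy⟩ := v
  cases n with
  | zero => rfl
  | succ n => exact congrArg (Sigma.mk n) (Subtype.ext (hc.eq y).symm)

/-- Vertices of a tree of preimages are equal if they have the same level and are equal as points
of the projective line. -/
theorem PreimageTree.ext {v v' : PreimageTree f x} (h1 : v.1 = v'.1) (h2 : v.2.1 = v'.2.1) :
    v = v' := by
  obtain ⟨n, y, hy⟩ := v
  obtain ⟨n', y', hy'⟩ := v'
  obtain rfl : n = n' := h1
  obtain rfl : y = y' := h2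
  rfl

/-- A bijection between trees of preimages that preserves levels and parents. -/
def IsTreeIso (e : PreimageTree f x ≃ PreimageTree f x') : Prop :=
  ∀ v, (e v).1 = v.1 ∧ (e v).parent = e v.parent

theorem IsTreeIso.symm {e : PreimageTree f x ≃ PreimageTree f x'} (he : IsTreeIso e) :
    IsTreeIso e.symm := by
  intro v
  obtain ⟨w, rfl⟩ := e.surjective v
  rw [(he w).2]
  simp only [Equiv.symm_apply_apply]
  exact ⟨(he w).1.symm, trivial⟩

theorem IsTreeIso.trans {M : Type*} [Field M] [Algebra K M] {z : M}
    {e : PreimageTree f x ≃ PreimageTree f x'} (he : IsTreeIso e)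
    {e' : PreimageTree f x' ≃ PreimageTree f z} (he' : IsTreeIso e') :
    IsTreeIso (e.trans e') := by
  intro v
  exact ⟨((he' _).1).trans (he v).1, ((he' _).2).trans (congrArg e' (he v).2)⟩

theorem mem_treeAut_iff_isTreeIso {g : Equiv.Perm (PreimageTree f x)} :
    g ∈ treeAut f x ↔ IsTreeIso g := Iff.rfl

/-- Conjugation by an isomorphism of trees. -/
def treeAutHom (e : PreimageTree f x ≃ PreimageTree f x') (he : IsTreeIso e) :
    treeAut f x →* treeAut f x' :=
  (e.permCongrHom.toMonoidHom.comp (treeAut f x).subtype).codRestrict (treeAut f x') fun g =>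
    (he.symm.trans (mem_treeAut_iff_isTreeIso.1 g.2)).trans he

theorem treeAutHom_apply (e : PreimageTree f x ≃ PreimageTree f x') (he : IsTreeIso e)
    (g : treeAut f x) (v : PreimageTree f x) :
    (treeAutHom e he g : Equiv.Perm _) (e v) = e ((g : Equiv.Perm _) v) := by
  change e ((g : Equiv.Perm _) (e.symm (e v))) = _
  rw [e.symm_apply_apply]

theorem treeAutHom_surjective (e : PreimageTree f x ≃ PreimageTree f x') (he : IsTreeIso e) :
    Function.Surjective (treeAutHom e he) := by
  refine fun g => ⟨treeAutHom e.symm he.symm g, Subtype.ext (Equiv.ext fun v => ?_)⟩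
  obtain ⟨w, rfl⟩ := e.surjective v
  rw [treeAutHom_apply]
  change e (e.symm ((g : Equiv.Perm _) (e w))) = _
  rw [e.apply_symm_apply]

/-- If every element of a subgroup `G'` of finite index of the automorphism group of a tree `T'`
comes from an element of a subgroup `G` of the automorphism group of an isomorphic tree `T`, then
`G` has finite index. -/
theorem finiteIndex_of_isTreeIso (e : PreimageTree f x ≃ PreimageTree f x') (he : IsTreeIso e)
    {G : Subgroup (treeAut f x)} {G' : Subgroup (treeAut f x')} (hG' : G'.FiniteIndex)
    (h : ∀ g' ∈ G', ∃ g ∈ G, ∀ v, e ((g : Equiv.Perm _) v) = (g' : Equiv.Perm _) (e v)) :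
    G.FiniteIndex := by
  -- The pullback of `G'` already has finite index, so it is enough that `G` contains it.
  have hle : G'.comap (treeAutHom e he) ≤ G := by
    intro g hg
    obtain ⟨g₁, hg₁, hv⟩ := h _ hg
    convert hg₁
    refine Subtype.ext (Equiv.ext fun v => e.injective ?_)
    rw [hv, treeAutHom_apply]
  have : (G'.comap (treeAutHom e he)).FiniteIndex := ⟨by
    rw [Subgroup.index_comap_of_surjective _ (treeAutHom_surjective e he)]
    exact hG'.index_ne_zero⟩
  exact Subgroup.finiteIndex_of_le hle

end Transfer

/-! ### Fibers over the vertices of the two trees avoid critical points. -/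

section Critical

universe u v w

variable {K : Type u} [Field K] (f : RatFunc K)

theorem iterate_ratMap_algHom {L : Type v} [Field L] [Algebra K L] {L' : Type w} [Field L']
    [Algebra K L'] (φ : L →ₐ[K] L') (n : ℕ) (z : OnePoint L) :
    (ratMap f L')^[n] (OnePoint.map φ z) = OnePoint.map φ ((ratMap f L)^[n] z) :=
  (Function.Semiconj.iterate_right
    (show Function.Semiconj (OnePoint.map φ) (ratMap f L) (ratMap f L') from
      fun z => (ratMap_algHom f φ z).symm) n).eq z |>.symm

theorem mem_range_of_onePoint_map_eq_some {X : Type v} {Y : Type w} {φ : X → Y} {z : OnePoint X}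
    {y : Y} (h : OnePoint.map φ z = OnePoint.some y) : y ∈ Set.range φ := by
  cases z with
  | infty => exact absurd h.symm (OnePoint.coe_ne_infty y)
  | coe x => exact ⟨x, OnePoint.coe_injective h⟩

/-- An iterated image of `∞` or of a point algebraic over `K` stays in the projective line of the
algebraic closure of `K` in `L`. -/
theorem exists_transcendental_of_iterate_eq {L : Type v} [Field L] [Algebra K L] {t : L}
    (ht : Transcendental K t) {n : ℕ} {c : OnePoint L}
    (h : (ratMap f L)^[n] c = OnePoint.some t) :
    ∃ a : L, c = OnePoint.some a ∧ Transcendental K a := by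
  have key : ∀ c' : OnePoint (algebraicClosure K L),
      c ≠ OnePoint.map (algebraicClosure K L).val c' := by
    rintro c' rfl
    rw [iterate_ratMap_algHom] at h
    obtain ⟨s, hs⟩ := mem_range_of_onePoint_map_eq_some h
    exact ht (hs ▸ (mem_algebraicClosure_iff.1 s.2))
  cases c with
  | infty => exact absurd rfl (key OnePoint.infty)
  | coe a =>
    refine ⟨a, rfl, fun ha => key (OnePoint.some ⟨a, mem_algebraicClosure_iff.2 ha⟩) rfl⟩

theorem not_isCriticalPoint_of_transcendental (hW : wronskian f.num f.denom ≠ 0) {L : Type v}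
    [Field L] [Algebra K L] {a : L} (ha : Transcendental K a) :
    ¬ IsCriticalPoint f L (OnePoint.some a) :=
  fun h => ha ⟨_, hW, h⟩

theorem fiber_ncard_eq_of_transcendental (hd : 1 ≤ ratDegree f)
    (hW : wronskian f.num f.denom ≠ 0) {L : Type v} [Field L] [IsSepClosed L] [Algebra K L] {t : L}
    (ht : Transcendental K t) {n : ℕ} {u : OnePoint L}
    (h : (ratMap f L)^[n] u = OnePoint.some t) :
    {z | ratMap f L z = u}.ncard = ratDegree f := by
  refine fiber_ncard_eq f hd (AlgebraicClosure L) fun c hc => ?_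
  have ht' : Transcendental K (algebraMap L (AlgebraicClosure L) t) :=
    (transcendental_algebraMap_iff (algebraMap L (AlgebraicClosure L)).injective).2 ht
  have : (ratMap f (AlgebraicClosure L))^[n + 1] c =
      OnePoint.some (algebraMap L (AlgebraicClosure L) t) := by
    rw [Function.iterate_succ_apply, hc]
    refine (iterate_ratMap_algHom f (IsScalarTower.toAlgHom K L (AlgebraicClosure L)) n u).trans ?_
    rw [h]
    rfl
  obtain ⟨a, rfl, ha⟩ := exists_transcendental_of_iterate_eq f ht' this
  exact not_isCriticalPoint_of_transcendental f hW ha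

variable {f} {α : K}

theorem not_isCriticalPoint_of_not_isStrictlyPostcritical (hα : ¬ IsStrictlyPostcritical f α)
    {M : Type v} [Field M] [Algebra K M] [Algebra.IsAlgebraic K M] {n : ℕ} (hn : 1 ≤ n)
    {c : OnePoint M} (hc : (ratMap f M)^[n] c = OnePoint.some (algebraMap K M α)) :
    ¬ IsCriticalPoint f M c := by
  intro hcrit
  let φ : M →ₐ[K] AlgebraicClosure K := IsAlgClosed.lift
  refine hα ⟨n, hn, OnePoint.map φ c, isCriticalPoint_algHom f φ hcrit, ?_⟩
  rw [iterate_ratMap_algHom, hc, OnePoint.map_some, φ.commutes]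

/-- If the Wronskian vanished, every finite point would be critical. But the fiber over `α` has no
critical point, hence has `d ≥ 2` points, one of which is finite. -/
theorem wronskian_ne_zero_of_not_isStrictlyPostcritical (hd : 2 ≤ ratDegree f)
    (hα : ¬ IsStrictlyPostcritical f α) : wronskian f.num f.denom ≠ 0 := by
  intro hW
  have hcrit : ∀ c : OnePoint (AlgebraicClosure K),
      ratMap f (AlgebraicClosure K) c = OnePoint.some (algebraMap K _ α) →
        ¬ IsCriticalPoint f (AlgebraicClosure K) c := fun c hc =>
    not_isCriticalPoint_of_not_isStrictlyPostcritical hα le_rfl hc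
  have hcard := fiber_ncard_eq f (by omega : 1 ≤ ratDegree f) (E := AlgebraicClosure K)
    (AlgebraicClosure K) (u := OnePoint.some (algebraMap K _ α)) fun c hc => hcrit c hc
  obtain ⟨z, hz, hz'⟩ := Set.exists_ne_of_one_lt_ncard (hcard ▸ hd) OnePoint.infty
  cases z with
  | infty => exact hz' rfl
  | coe z =>
    refine hcrit _ hz ?_
    change aeval z _ = 0
    rw [hW, map_zero]

theorem fiber_ncard_eq_of_not_isStrictlyPostcritical (hd : 1 ≤ ratDegree f)
    (hα : ¬ IsStrictlyPostcritical f α) {E : Type v} [Field E] [IsSepClosed E] [Algebra K E]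
    [Algebra.IsAlgebraic K E] {n : ℕ} {u : OnePoint E}
    (h : (ratMap f E)^[n] u = OnePoint.some (algebraMap K E α)) :
    {z | ratMap f E z = u}.ncard = ratDegree f := by
  have : Algebra.IsAlgebraic K (AlgebraicClosure E) := Algebra.IsAlgebraic.trans K E _
  refine fiber_ncard_eq f hd (AlgebraicClosure E) fun c hc =>
    not_isCriticalPoint_of_not_isStrictlyPostcritical hα (Nat.le_add_left 1 n) ?_
  rw [Function.iterate_succ_apply, hc]
  refine (iterate_ratMap_algHom f (IsScalarTower.toAlgHom K E (AlgebraicClosure E)) n u).trans ?_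
  rw [h, OnePoint.map_some, AlgHom.commutes]

end Critical

universe u v w

/-! ### Automorphisms of a separable closure moving one transcendental element to another. -/

section SeparablyClosed

/-- Two embeddings of a field in separably closed fields that are separable over it are conjugate
under an isomorphism. -/
theorem exists_ringEquiv_of_isSepClosure {k : Type u} [Field k] {Ω₁ : Type v} [Field Ω₁]
    {Ω₂ : Type w} [Field Ω₂] (i : k →+* Ω₁) (j : k →+* Ω₂)
    (hi : letI := i.toAlgebra; IsSepClosure k Ω₁) (hj : letI := j.toAlgebra; IsSepClosure k Ω₂) :
    ∃ φ : Ω₁ ≃+* Ω₂, ∀ x, φ (i x) = j x := by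
  let := i.toAlgebra
  let := j.toAlgebra
  have := hi
  have := hj
  exact ⟨(IsSepClosure.equiv k Ω₁ Ω₂).toRingEquiv, (IsSepClosure.equiv k Ω₁ Ω₂).commutes⟩

open IntermediateField in
-- Both `t` and `a` make `Ω` a separable closure of the rational function field over `F`, and
-- separable closures are unique.
theorem exists_algEquiv_of_transcendental {F : Type u} [Field F] {Ω : Type v} [Field Ω]
    [Algebra F Ω] [IsSepClosed Ω] {t a : Ω} (ht : Transcendental F t) (ha : Transcendental F a)
    [Algebra.IsSeparable F⟮t⟯ Ω] [Algebra.IsSeparable F⟮a⟯ Ω] :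
    ∃ φ : Ω ≃ₐ[F] Ω, φ t = a := by
  have key : ∀ {s : Ω} (hs : Transcendental F s) [Algebra.IsSeparable F⟮s⟯ Ω],
      letI := ((algebraMap F⟮s⟯ Ω).comp
        (RatFunc.algEquivOfTranscendental s hs : RatFunc F →+* F⟮s⟯)).toAlgebra
      IsSepClosure (RatFunc F) Ω := by
    intro s hs _
    let := ((algebraMap F⟮s⟯ Ω).comp
        (RatFunc.algEquivOfTranscendental s hs : RatFunc F →+* F⟮s⟯)).toAlgebra
    refine ⟨inferInstance, ?_⟩
    exact Algebra.IsSeparable.of_equiv_equiv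
      (RatFunc.algEquivOfTranscendental s hs).symm.toRingEquiv (RingEquiv.refl Ω) <| by
        ext x
        change algebraMap F⟮s⟯ Ω (RatFunc.algEquivOfTranscendental s hs
          ((RatFunc.algEquivOfTranscendental s hs).symm x)) = algebraMap F⟮s⟯ Ω x
        rw [AlgEquiv.apply_symm_apply]
  obtain ⟨φ, hφ⟩ := exists_ringEquiv_of_isSepClosure _ _ (key ht) (key ha)
  refine ⟨AlgEquiv.ofRingEquiv (f := φ) fun x => ?_, ?_⟩
  · have := hφ (algebraMap F (RatFunc F) x)
    simpa only [RingHom.comp_apply, RingHom.coe_coe, AlgEquiv.commutes,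
      ← IsScalarTower.algebraMap_apply] using this
  · change φ t = a
    have := hφ RatFunc.X
    simpa only [RingHom.comp_apply, RingHom.coe_coe, IntermediateField.algebraMap_apply,
      RatFunc.algEquivOfTranscendental_X] using this

end SeparablyClosed

/-! ### Moving the generic point to one of its preimages. -/

section SelfSimilar

variable {K : Type u} [Field K] (f : RatFunc K) {Ω : Type v} [Field Ω] [Algebra (RatFunc K) Ω]
  [Algebra K Ω] [IsScalarTower K (RatFunc K) Ω]

theorem transcendental_genericPoint : Transcendental K (genericPoint (K := K) Ω) :=
  (transcendental_algebraMap_iff (algebraMap (RatFunc K) Ω).injective).2 RatFunc.transcendental_X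

theorem algebraMap_ratFunc_mem {F : Type w} [Field F] [Algebra K F] [Algebra F Ω]
    [IsScalarTower K F Ω] (E : IntermediateField F Ω) (ht : genericPoint (K := K) Ω ∈ E)
    (r : RatFunc K) : algebraMap (RatFunc K) Ω r ∈ E := by
  have hp : ∀ p : K[X], algebraMap (RatFunc K) Ω (algebraMap K[X] (RatFunc K) p) ∈ E := by
    intro p
    have : algebraMap (RatFunc K) Ω (algebraMap K[X] (RatFunc K) p) =
        aeval (genericPoint (K := K) Ω) p := by
      rw [genericPoint, aeval_algebraMap_apply, ← RatFunc.algebraMap_X, aeval_algebraMap_apply,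
        aeval_X_left_apply]
    rw [this, aeval_eq_sum_range]
    refine sum_mem fun i _ => ?_
    rw [Algebra.smul_def, IsScalarTower.algebraMap_apply K F Ω]
    exact mul_mem (E.algebraMap_mem _) (pow_mem ht i)
  rw [← RatFunc.num_div_denom r, map_div₀]
  exact div_mem (hp _) (hp _)

open IntermediateField in
theorem isSeparable_adjoin_of_genericPoint_mem [Algebra.IsSeparable (RatFunc K) Ω] {F : Type w}
    [Field F] [Algebra K F] [Algebra F Ω] [IsScalarTower K F Ω] (E : IntermediateField F Ω)
    (ht : genericPoint (K := K) Ω ∈ E) : Algebra.IsSeparable E Ω := by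
  let : Algebra (RatFunc K) E :=
    ((algebraMap (RatFunc K) Ω).codRestrict E.toSubfield
      (algebraMap_ratFunc_mem E ht)).toAlgebra
  have : IsScalarTower (RatFunc K) E Ω := IsScalarTower.of_algebraMap_eq fun _ => rfl
  exact Algebra.isSeparable_tower_top_of_isSeparable (RatFunc K) E Ω

open IntermediateField in
/-- For a preimage `a` of the generic point `t` there is an automorphism of `K(t)^sep` over `K^sep`
that sends `t` to `a`. -/
theorem exists_algEquiv_genericPoint [IsSepClosure (RatFunc K) Ω] {a : Ω}
    (ha : ratMap f Ω (OnePoint.some a) = OnePoint.some (genericPoint (K := K) Ω)) :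
    ∃ φ : Ω ≃ₐ[separableClosure K Ω] Ω, φ (genericPoint (K := K) Ω) = a := by
  have : IsSepClosed Ω := IsSepClosure.sep_closed (RatFunc K)
  have : Algebra.IsAlgebraic K (separableClosure K Ω) := Algebra.IsSeparable.isAlgebraic _ _
  have ht := transcendental_genericPoint (K := K) (Ω := Ω)
  obtain ⟨a', ha', hat⟩ := exists_transcendental_of_iterate_eq f ht (n := 1)
    (c := OnePoint.some a) ha
  obtain rfl := OnePoint.coe_injective ha'
  have hs : ∀ {s : Ω}, Transcendental K s → Transcendental (separableClosure K Ω) s :=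
    fun h h' => h (h'.restrictScalars K)
  -- Since `t = f(a)`, the field `K^sep(a)` contains `K(t)`, so `Ω` is separable over it.
  have hmem : genericPoint (K := K) Ω ∈ (separableClosure K Ω)⟮a⟯ := by
    let c : OnePoint (separableClosure K Ω)⟮a⟯ := OnePoint.some (AdjoinSimple.gen _ a)
    have h1 := ratMap_algHom f ((separableClosure K Ω)⟮a⟯.val.restrictScalars K) c
    have h2 : ratMap f Ω (OnePoint.map ((separableClosure K Ω)⟮a⟯.val.restrictScalars K) c) =
      OnePoint.some (genericPoint (K := K) Ω) := ha
    rw [h1] at h2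
    obtain ⟨s, hs⟩ := mem_range_of_onePoint_map_eq_some h2
    exact hs ▸ s.2
  have := isSeparable_adjoin_of_genericPoint_mem (K := K)
    (separableClosure K Ω)⟮genericPoint (K := K) Ω⟯ (mem_adjoin_simple_self _ _)
  have := isSeparable_adjoin_of_genericPoint_mem (K := K) (separableClosure K Ω)⟮a⟯ hmem
  exact exists_algEquiv_of_transcendental (hs ht) (hs hat)

end SelfSimilar

/-! ### Subtrees, sections, and the pigeonhole argument. -/

section Tree

variable {K : Type u} [Field K] {f : RatFunc K} {Ω : Type v} [Field Ω] [Algebra K Ω] {t : Ω}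

/-- The embedding of the tree of preimages of `t` onto the subtree above a child `φ t` of `t`. -/
def subtreeEmb (φ : Ω ≃ₐ[K] Ω) (hφ : ratMap f Ω (OnePoint.some (φ t)) = OnePoint.some t) :
    PreimageTree f t ↪ PreimageTree f t where
  toFun v := ⟨v.1 + 1, OnePoint.map φ v.2.1, by
    rw [Function.iterate_succ_apply', ratMap_iterate_map, v.2.2, OnePoint.map_some, hφ]⟩
  inj' v v' h := by
    refine PreimageTree.ext (Nat.succ_injective (congrArg (fun z : PreimageTree f t => z.1) h)) ?_
    exact onePoint_map_injective φ.injective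
      (congrArg (fun z : PreimageTree f t => z.2.1) h)

variable {φ ψ : Ω ≃ₐ[K] Ω} (hφ : ratMap f Ω (OnePoint.some (φ t)) = OnePoint.some t)
  (hψ : ratMap f Ω (OnePoint.some (ψ t)) = OnePoint.some t)

theorem mem_range_subtreeEmb_iff {n : ℕ} {y : OnePoint Ω}
    {hy : (ratMap f Ω)^[n + 1] y = OnePoint.some t} :
    (⟨n + 1, y, hy⟩ : PreimageTree f t) ∈ Set.range (subtreeEmb φ hφ) ↔
      (ratMap f Ω)^[n] y = OnePoint.some (φ t) := by
  constructor
  · rintro ⟨v, hv⟩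
    have h1 : v.1 = n := Nat.succ_injective (congrArg (fun z : PreimageTree f t => z.1) hv)
    have h2 : OnePoint.map φ v.2.1 = y := congrArg (fun z : PreimageTree f t => z.2.1) hv
    rw [← h2, ratMap_iterate_map, ← h1, v.2.2, OnePoint.map_some]
  · intro h
    have e : OnePoint.map φ (OnePoint.map φ.symm y) = y := by
      cases y <;> simp
    refine ⟨⟨n, OnePoint.map φ.symm y, ?_⟩, PreimageTree.ext rfl e⟩
    rw [ratMap_iterate_map, h, OnePoint.map_some, AlgEquiv.symm_apply_apply]

theorem disjoint_range_subtreeEmb (hne : φ t ≠ ψ t) :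
    Disjoint (Set.range (subtreeEmb φ hφ)) (Set.range (subtreeEmb ψ hψ)) := by
  rw [Set.disjoint_left]
  rintro ⟨n, y, hy⟩ h h'
  cases n with
  | zero =>
    obtain ⟨v, hv⟩ := h
    exact absurd (congrArg (fun z : PreimageTree f t => z.1) hv) (Nat.succ_ne_zero _)
  | succ n =>
    exact hne (OnePoint.coe_injective (((mem_range_subtreeEmb_iff hφ).1 h).symm.trans
      ((mem_range_subtreeEmb_iff hψ).1 h')))

theorem eq_root_of_fst_eq_zero {v v' : PreimageTree f t} (h : v.1 = 0) (h' : v'.1 = 0) :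
    v = v' := by
  obtain ⟨n, y, hy⟩ := v
  obtain ⟨n', y', hy'⟩ := v'
  obtain rfl : n = 0 := h
  obtain rfl : n' = 0 := h'
  exact PreimageTree.ext rfl (hy.trans hy'.symm)

theorem parent_subtreeEmb_of_ne_zero {v : PreimageTree f t} (h : v.1 ≠ 0) :
    (subtreeEmb φ hφ v).parent = subtreeEmb φ hφ v.parent := by
  obtain ⟨n, y, hy⟩ := v
  cases n with
  | zero => exact absurd rfl h
  | succ n => exact PreimageTree.ext rfl (ratMap_map f φ y)

theorem parent_notMem_range_subtreeEmb {v : PreimageTree f t}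
    (hv : v ∉ Set.range (subtreeEmb φ hφ)) : v.parent ∉ Set.range (subtreeEmb φ hφ) := by
  obtain ⟨n, y, hy⟩ := v
  match n, hy, hv with
  | 0, hy, hv => exact hv
  | 1, hy, hv =>
    rintro ⟨v, hv⟩
    exact absurd (congrArg (fun z : PreimageTree f t => z.1) hv) (Nat.succ_ne_zero _)
  | n + 2, hy, hv =>
    intro h
    exact hv ((mem_range_subtreeEmb_iff hφ).2 ((mem_range_subtreeEmb_iff
      (n := n) (y := ratMap f Ω y) (hy := hy) hφ).1 h))

open Classical in
/-- The automorphism of the tree that acts as `g` on the subtree above the child `φ t` of the root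
and trivially elsewhere. -/
noncomputable def extendSubtree (g : treeAut f t) : treeAut f t :=
  ⟨(g : Equiv.Perm _).viaEmbedding (subtreeEmb φ hφ), by
    intro v
    by_cases hv : v ∈ Set.range (subtreeEmb φ hφ)
    · obtain ⟨w, rfl⟩ := hv
      rw [Equiv.Perm.viaEmbedding_apply]
      refine ⟨congrArg (· + 1) (g.2 w).1, ?_⟩
      -- The root of the subtree is special: its parent lies outside the subtree, but every tree
      -- automorphism fixes the root.
      by_cases hw : w.1 = 0
      · have e : (g : Equiv.Perm _) w = w := eq_root_of_fst_eq_zero ((g.2 w).1.trans hw) hw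
        have hroot : (subtreeEmb φ hφ w).parent ∉ Set.range (subtreeEmb φ hφ) := by
          rintro ⟨w', hw'⟩
          have := congrArg (fun z : PreimageTree f t => z.1) hw'
          obtain ⟨n, y, hy⟩ := w
          obtain rfl : n = 0 := hw
          exact absurd this (Nat.succ_ne_zero _)
        rw [e, Equiv.Perm.viaEmbedding_apply_of_notMem _ _ _ hroot]
      · have hgw : ((g : Equiv.Perm _) w).1 ≠ 0 := (g.2 w).1.trans_ne hw
        rw [parent_subtreeEmb_of_ne_zero hφ hw, parent_subtreeEmb_of_ne_zero hφ hgw,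
          Equiv.Perm.viaEmbedding_apply, (g.2 w).2]
    · rw [Equiv.Perm.viaEmbedding_apply_of_notMem _ _ _ hv,
        Equiv.Perm.viaEmbedding_apply_of_notMem _ _ _ (parent_notMem_range_subtreeEmb hφ hv)]
      exact ⟨rfl, rfl⟩⟩

/-- The automorphism `g` of the tree fixes the child `φ t` of the root, and acts as `h` on the
subtree above it. -/
def IsSection (g h : treeAut f t) : Prop :=
  ∀ v, (g : Equiv.Perm _) (subtreeEmb φ hφ v) = subtreeEmb φ hφ ((h : Equiv.Perm _) v)

variable {hφ hψ}

theorem IsSection.mul {g h g' h' : treeAut f t} (H : IsSection hφ g h) (H' : IsSection hφ g' h') :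
    IsSection hφ (g * g') (h * h') := by
  intro v
  change (g : Equiv.Perm _) ((g' : Equiv.Perm _) _) =
    subtreeEmb φ hφ ((h : Equiv.Perm _) ((h' : Equiv.Perm _) v))
  rw [H', H]

theorem IsSection.inv {g h : treeAut f t} (H : IsSection hφ g h) : IsSection hφ g⁻¹ h⁻¹ := by
  intro v
  change (g : Equiv.Perm _).symm _ = subtreeEmb φ hφ ((h : Equiv.Perm _).symm v)
  rw [Equiv.symm_apply_eq, H, Equiv.apply_symm_apply]

variable (hφ hψ)

theorem isSection_extendSubtree (g : treeAut f t) : IsSection hφ (extendSubtree hφ g) g :=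
  fun v => Equiv.Perm.viaEmbedding_apply _ _ v

theorem isSection_extendSubtree_of_ne (hne : φ t ≠ ψ t) (g : treeAut f t) :
    IsSection hψ (extendSubtree hφ g) 1 :=
  fun v => Equiv.Perm.viaEmbedding_apply_of_notMem _ _ _
    (Set.disjoint_right.1 (disjoint_range_subtreeEmb hφ hψ hne) ⟨v, rfl⟩)

/-- A subgroup of finite index of the automorphism group of the tree that contains the sections of
its elements at two vertices of the first level is the whole group. -/
theorem eq_top_of_finiteIndex_of_isSection {G : Subgroup (treeAut f t)} [hG : G.FiniteIndex]
    (hne : φ t ≠ ψ t) (hGφ : ∀ g ∈ G, ∀ h, IsSection hφ g h → h ∈ G)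
    (hGψ : ∀ g ∈ G, ∀ h, IsSection hψ g h → h ∈ G) : G = ⊤ := by
  rw [eq_top_iff]
  intro τ _
  -- `s n` is `τ` transplanted above the vertex reached by `n` steps in the direction of `ψ` and
  -- then one in the direction of `φ`.
  let s : ℕ → treeAut f t := fun n => (extendSubtree hψ)^[n] (extendSubtree hφ τ)
  have hs : ∀ n, s (n + 1) = extendSubtree hψ (s n) := fun n =>
    Function.iterate_succ_apply' _ _ _
  -- Sections at `ψ t` lower both indices by one. Once the first is `0`, the section at `φ t` is
  -- `τ⁻¹`, because the other factor is supported above `ψ t`.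
  have peel : ∀ i k, (s i)⁻¹ * s (i + (k + 1)) ∈ G → τ ∈ G := by
    intro i k
    induction i with
    | zero =>
      intro h
      rw [zero_add, hs] at h
      have h1 : IsSection hφ ((s 0)⁻¹ * extendSubtree hψ (s k)) (τ⁻¹ * 1) :=
        (isSection_extendSubtree hφ τ).inv.mul (isSection_extendSubtree_of_ne hψ hφ hne.symm _)
      have h2 := hGφ _ h _ h1
      rwa [mul_one, inv_mem_iff] at h2
    | succ i ih =>
      intro h
      rw [show i + 1 + (k + 1) = (i + (k + 1)) + 1 by omega, hs, hs] at h
      exact ih (hGψ _ h _ ((isSection_extendSubtree hψ _).inv.mul (isSection_extendSubtree hψ _)))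
  have : Finite (treeAut f t ⧸ G) := Subgroup.finite_quotient_of_finiteIndex
  obtain ⟨i, j, hij, h⟩ := Finite.exists_ne_map_eq_of_infinite
    (fun n => (QuotientGroup.mk (s n) : treeAut f t ⧸ G))
  rcases lt_or_gt_of_ne hij with hlt | hlt
  · obtain ⟨k, rfl⟩ := Nat.exists_eq_add_of_lt hlt
    exact peel i k (QuotientGroup.eq.1 h)
  · obtain ⟨k, rfl⟩ := Nat.exists_eq_add_of_lt hlt
    exact peel j k (QuotientGroup.eq.1 h.symm)

end Tree

/-! ### From finite index to the whole automorphism group. -/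

section Galois

variable {K : Type u} [Field K] {f : RatFunc K} {Ω : Type v} [Field Ω] [Algebra (RatFunc K) Ω]
  [Algebra K Ω] [IsScalarTower K (RatFunc K) Ω]

theorem ringHom_ratFunc_ext {R : Type w} [Field R] {i j : RatFunc K →+* R}
    (hC : ∀ x : K, i (algebraMap K _ x) = j (algebraMap K _ x)) (hX : i RatFunc.X = j RatFunc.X) :
    i = j := by
  have hp : ∀ p : K[X], i (algebraMap K[X] _ p) = j (algebraMap K[X] _ p) := by
    intro p
    refine DFunLike.congr_fun (f := i.comp (algebraMap K[X] _)) (g := j.comp (algebraMap K[X] _))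
      (Polynomial.ringHom_ext (fun x => ?_) ?_) p
    · have e : algebraMap K[X] (RatFunc K) (C x) = algebraMap K (RatFunc K) x := by simp
      simpa only [RingHom.comp_apply, e] using hC x
    · simpa only [RingHom.comp_apply, RatFunc.algebraMap_X] using hX
  refine RingHom.ext fun r => ?_
  rw [← RatFunc.num_div_denom r, map_div₀, map_div₀, hp, hp]

variable (f Ω) in
/-- The arboreal representation of the Galois group of `K(t)^sep` over `K(t)`. -/
noncomputable def genericRep : Gal(Ω/RatFunc K) →* treeAut f (genericPoint (K := K) Ω) :=
  arborealRep f (RatFunc K) (Set.mem_range_self RatFunc.X)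

/-- The image of the Galois group of `K(t)^sep` over `K(t)` in the automorphism group of the tree
contains the sections of its elements, up to elements of the Galois group that agree on `K^sep`. -/
theorem exists_genericRep_eq_of_isSection {φ : Ω ≃ₐ[separableClosure K Ω] Ω}
    (hφ : ratMap f Ω (OnePoint.some (φ.restrictScalars K (genericPoint (K := K) Ω))) =
      OnePoint.some (genericPoint (K := K) Ω))
    (σ : Gal(Ω/RatFunc K)) {h : treeAut f (genericPoint (K := K) Ω)}
    (H : IsSection hφ (genericRep f Ω σ) h) :
    ∃ σ' : Gal(Ω/RatFunc K), genericRep f Ω σ' = h ∧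
      ∀ x ∈ separableClosure K Ω, σ' x = σ x := by
  let root : PreimageTree f (genericPoint (K := K) Ω) := ⟨0, OnePoint.some _, rfl⟩
  -- The section hypothesis at the root says that `σ` fixes `φ t`, so that `φ⁻¹ σ φ` fixes `t`.
  have hroot : σ (φ (genericPoint (K := K) Ω)) = φ (genericPoint (K := K) Ω) := by
    have h1 := H root
    have h2 : (h : Equiv.Perm _) root = root := eq_root_of_fst_eq_zero (h.2 root).1 rfl
    rw [h2] at h1
    exact OnePoint.coe_injective (congrArg (fun z : PreimageTree f _ => z.2.1) h1)
  let σ₀ : Ω ≃+* Ω := (φ.toRingEquiv.trans σ.toRingEquiv).trans φ.symm.toRingEquiv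
  have hσ₀ : ∀ x, σ₀ x = φ.symm (σ (φ x)) := fun _ => rfl
  have hring : (σ₀ : Ω →+* Ω).comp (algebraMap (RatFunc K) Ω) = algebraMap (RatFunc K) Ω := by
    refine ringHom_ratFunc_ext (fun x => ?_) ?_
    · change σ₀ _ = _
      rw [← IsScalarTower.algebraMap_apply, hσ₀]
      have e : φ (algebraMap K Ω x) = algebraMap K Ω x := (φ.restrictScalars K).commutes x
      have e' : σ (algebraMap K Ω x) = algebraMap K Ω x := (σ.restrictScalars K).commutes x
      rw [e, e', ← e, AlgEquiv.symm_apply_apply, e]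
    · change σ₀ (genericPoint (K := K) Ω) = _
      rw [hσ₀, hroot, AlgEquiv.symm_apply_apply]
      rfl
  refine ⟨AlgEquiv.ofRingEquiv (f := σ₀) (fun r => DFunLike.congr_fun hring r), ?_, ?_⟩
  · refine Subtype.ext (Equiv.ext fun v => (subtreeEmb _ hφ).injective ?_)
    refine Eq.trans ?_ (H v)
    refine PreimageTree.ext rfl ?_
    obtain ⟨n, y, hy⟩ := v
    change OnePoint.map φ (OnePoint.map σ₀ y) = OnePoint.map σ (OnePoint.map φ y)
    cases y with
    | infty => rfl
    | coe y =>
      simp only [OnePoint.map_some]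
      rw [hσ₀, AlgEquiv.apply_symm_apply]
  · intro x hx
    change σ₀ x = σ x
    -- `σ` preserves `K^sep` and `φ` is the identity there, so conjugation by `φ` does not change
    -- the action on `K^sep`.
    have hσx : σ x ∈ separableClosure K Ω :=
      mem_separableClosure_iff.2 (((σ.restrictScalars K).isSeparable_iff (x := x)).2
        (mem_separableClosure_iff.1 hx))
    have e : φ x = x := φ.commutes ⟨x, hx⟩
    have e' : φ (σ x) = σ x := φ.commutes ⟨σ x, hσx⟩
    rw [hσ₀, e, AlgEquiv.symm_apply_eq, e']

theorem mem_geometricGroup_of_fixes {σ : Gal(Ω/RatFunc K)}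
    (hσ : ∀ x ∈ separableClosure K Ω, σ x = x) :
    genericRep f Ω σ ∈ geometricGroup f Ω := by
  have hmem : σ ∈ (geometricField K Ω).fixingSubgroup := by
    rw [IntermediateField.mem_fixingSubgroup_iff]
    intro x hx
    induction hx using IntermediateField.adjoin_induction with
    | mem x hx => exact hσ x hx
    | algebraMap r => exact σ.commutes r
    | add x y _ _ hx hy => exact (map_add σ x y).trans (congrArg₂ _ hx hy)
    | inv x _ hx => exact (map_inv₀ σ x).trans (congrArg _ hx)
    | mul x y _ _ hx hy => exact (map_mul σ x y).trans (congrArg₂ _ hx hy)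
  exact ⟨IntermediateField.fixingSubgroupEquiv _ ⟨σ, hmem⟩, rfl⟩

theorem geometricGroup_le_arithmeticGroup : geometricGroup f Ω ≤ arithmeticGroup f Ω := by
  rintro _ ⟨σ, rfl⟩
  exact ⟨σ.restrictScalars (RatFunc K), rfl⟩

/-- If the arithmetic group has finite index, then the geometric group is the whole automorphism
group of the tree. -/
theorem geometricGroup_eq_top_of_finiteIndex [IsSepClosure (RatFunc K) Ω] (hd : 2 ≤ ratDegree f)
    (hW : wronskian f.num f.denom ≠ 0) (hG : (arithmeticGroup f Ω).FiniteIndex) :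
    geometricGroup f Ω = ⊤ := by
  have : IsSepClosed Ω := IsSepClosure.sep_closed (RatFunc K)
  have ht := transcendental_genericPoint (K := K) (Ω := Ω)
  have hcard := fiber_ncard_eq_of_transcendental f (by omega) hW ht (n := 0) rfl
  obtain ⟨y, z, hy, hz, hyz⟩ := (Set.one_lt_ncard_iff (fiber_finite f (by omega) _)).1
    (hcard ▸ hd : 1 < _)
  obtain ⟨a, rfl, -⟩ := exists_transcendental_of_iterate_eq f ht (n := 1) hy
  obtain ⟨b, rfl, -⟩ := exists_transcendental_of_iterate_eq f ht (n := 1) hz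
  obtain ⟨φ, rfl⟩ := exists_algEquiv_genericPoint f hy
  obtain ⟨ψ, rfl⟩ := exists_algEquiv_genericPoint f hz
  have hφ : ratMap f Ω (OnePoint.some (φ.restrictScalars K (genericPoint (K := K) Ω))) =
      OnePoint.some (genericPoint (K := K) Ω) := hy
  have hψ : ratMap f Ω (OnePoint.some (ψ.restrictScalars K (genericPoint (K := K) Ω))) =
      OnePoint.some (genericPoint (K := K) Ω) := hz
  have hne : φ.restrictScalars K (genericPoint (K := K) Ω) ≠
      ψ.restrictScalars K (genericPoint (K := K) Ω) := fun h => hyz (congrArg OnePoint.some h)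
  have htop : arithmeticGroup f Ω = ⊤ := by
    refine eq_top_of_finiteIndex_of_isSection hφ hψ hne ?_ ?_
    · rintro _ ⟨σ, rfl⟩ h H
      obtain ⟨σ', rfl, -⟩ := exists_genericRep_eq_of_isSection hφ σ H
      exact ⟨σ', rfl⟩
    · rintro _ ⟨σ, rfl⟩ h H
      obtain ⟨σ', rfl, -⟩ := exists_genericRep_eq_of_isSection hψ σ H
      exact ⟨σ', rfl⟩
  rw [eq_top_iff]
  intro τ _
  -- The sections of this `σ` are `τ` at `φ t` and `1` at `ψ t`, with lifts `σ₁` and `σ₂` that have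
  -- the same restriction to `K^sep`.
  obtain ⟨σ, hσ⟩ : extendSubtree hφ τ ∈ arithmeticGroup f Ω := htop ▸ Subgroup.mem_top _
  obtain ⟨σ₁, h₁, h₁'⟩ := exists_genericRep_eq_of_isSection hφ σ (h := τ)
    (hσ ▸ isSection_extendSubtree hφ τ)
  obtain ⟨σ₂, h₂, h₂'⟩ := exists_genericRep_eq_of_isSection hψ σ (h := 1)
    (hσ ▸ isSection_extendSubtree_of_ne hφ hψ hne τ)
  have : genericRep f Ω (σ₂⁻¹ * σ₁) = τ := by
    rw [map_mul, map_inv, h₁, h₂, inv_one, one_mul]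
  rw [← this]
  refine mem_geometricGroup_of_fixes fun x hx => ?_
  change σ₂.symm (σ₁ x) = x
  rw [AlgEquiv.symm_apply_eq, h₁' x hx, h₂' x hx]

end Galois


/-! ### Hensel's lemma by Newton iteration. -/

section Hensel

variable {E : Type v} [Field E]

/-- Hensel's lemma over a ring of formal power series, for polynomials that need not be monic. -/
theorem exists_isRoot_powerSeries (G : (PowerSeries E)[X]) (c : E)
    (h0 : (G.map PowerSeries.constantCoeff).eval c = 0)
    (h1 : (derivative (G.map PowerSeries.constantCoeff)).eval c ≠ 0) :
    ∃ r : PowerSeries E, G.eval r = 0 ∧ PowerSeries.constantCoeff r = c := by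
  have hev : ∀ (H : (PowerSeries E)[X]) (r : PowerSeries E), PowerSeries.constantCoeff r = c →
      PowerSeries.constantCoeff (H.eval r) = (H.map PowerSeries.constantCoeff).eval c := by
    intro H r hr
    rw [← hr, eval_map_apply]
  let P : ℕ → PowerSeries E → Prop := fun n r =>
    PowerSeries.constantCoeff r = c ∧ (PowerSeries.X : PowerSeries E) ^ (n + 1) ∣ G.eval r
  have step : ∀ n r, P n r → ∃ r', P (n + 1) r' ∧ (PowerSeries.X : PowerSeries E) ^ (n + 1) ∣
      r' - r := by
    rintro n r ⟨hr, q, hq⟩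
    have hu : IsUnit ((derivative G).eval r) := by
      rw [PowerSeries.isUnit_iff_constantCoeff, hev _ r hr, ← derivative_map]
      exact h1.isUnit
    obtain ⟨u, hu⟩ := hu.exists_right_inv
    have hd : (PowerSeries.X : PowerSeries E) ^ (n + 1) ∣
        r + -(u * q * PowerSeries.X ^ (n + 1)) - r := ⟨-(u * q), by ring⟩
    refine ⟨r + -(u * q * PowerSeries.X ^ (n + 1)), ⟨?_, ?_⟩, hd⟩
    · simp [hr]
    · obtain ⟨k, hk⟩ := binomExpansion G r (-(u * q * PowerSeries.X ^ (n + 1)))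
      rw [hk, hq]
      refine ⟨k * (u * q) ^ 2 * PowerSeries.X ^ n, ?_⟩
      linear_combination (-(PowerSeries.X ^ (n + 1) * q)) * hu
  have start : P 0 (PowerSeries.C c) := by
    refine ⟨by simp, ?_⟩
    rw [zero_add, pow_one, PowerSeries.X_dvd_iff, hev _ _ (by simp), h0]
  choose! next hnext hdvd using step
  let s : ℕ → PowerSeries E := fun n => Nat.rec (PowerSeries.C c) (fun n r => next n r) n
  have hP : ∀ n, P n (s n) := fun n => by
    induction n with
    | zero => exact start
    | succ n ih => exact hnext n _ ih
  have hs : ∀ n m, n ≤ m → (PowerSeries.X : PowerSeries E) ^ (n + 1) ∣ s m - s n := by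
    intro n m hnm
    induction m, hnm using Nat.le_induction with
    | base => simp
    | succ m hnm ih =>
      have h2 : (PowerSeries.X : PowerSeries E) ^ (n + 1) ∣ s (m + 1) - s m :=
        (pow_dvd_pow _ (by omega)).trans (hdvd m _ (hP m))
      have := dvd_add h2 ih
      rwa [sub_add_sub_cancel] at this
  -- The limit of the approximations: coefficient `n` no longer changes after stage `n`.
  let r : PowerSeries E := PowerSeries.mk fun n => PowerSeries.coeff n (s n)
  have hr : ∀ n, (PowerSeries.X : PowerSeries E) ^ (n + 1) ∣ r - s n := by
    intro n
    rw [PowerSeries.X_pow_dvd_iff]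
    intro m hm
    have h2 := PowerSeries.X_pow_dvd_iff.1 (hs m n (by omega)) m (by omega)
    rw [map_sub, sub_eq_zero] at h2 ⊢
    rw [h2, PowerSeries.coeff_mk]
  refine ⟨r, ?_, ?_⟩
  · refine PowerSeries.ext fun n => ?_
    have h2 : (PowerSeries.X : PowerSeries E) ^ (n + 1) ∣ G.eval r := by
      have := dvd_add ((hr n).trans (sub_dvd_eval_sub r (s n) G)) (hP n).2
      rwa [sub_add_cancel] at this
    rw [PowerSeries.X_pow_dvd_iff.1 h2 n (Nat.lt_succ_self n), map_zero]
  · have h2 := (PowerSeries.X_dvd_iff.1 ((dvd_pow_self _ (Nat.succ_ne_zero 0)).trans (hr 0)))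
    rw [map_sub, sub_eq_zero] at h2
    exact h2.trans (hP 0).1

end Hensel

/-! ### Reduction of the projective line over Laurent series to the residue field. -/

section Reduction

variable (K : Type u) [Field K] (E : Type v) [Field E] [Algebra K E]

/-- The residue map `E⟦X⟧ → E` of the ring of power series, as a homomorphism of algebras. -/
noncomputable def residueHom : PowerSeries E →ₐ[K] E :=
  { PowerSeries.constantCoeff with commutes' := fun x => by simp [PowerSeries.algebraMap_apply] }

variable {K E}

/-- Power series over a field form a valuation ring, so `z` or `1 / z` is integral and coordinates
can be taken with nonzero reduction. -/
theorem exists_homogPoint_algebraMap_eq (z : OnePoint (FractionRing (PowerSeries E))) :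
    ∃ x y : PowerSeries E, (PowerSeries.constantCoeff x ≠ 0 ∨ PowerSeries.constantCoeff y ≠ 0) ∧
      homogPoint (algebraMap _ (FractionRing (PowerSeries E)) x) (algebraMap _ _ y) = z := by
  cases z with
  | infty => exact ⟨1, 0, by simp, by simp⟩
  | coe z =>
    rcases ValuationRing.isInteger_or_isInteger (PowerSeries E) z with ⟨r, hr⟩ | ⟨r, hr⟩
    · exact ⟨r, 1, by simp, by rw [map_one, homogPoint_one_right, hr]⟩
    · by_cases hz : z = 0
      · exact ⟨0, 1, by simp, by simp [hz]⟩
      · refine ⟨1, r, by simp, ?_⟩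
        rw [hr, map_one, homogPoint_of_ne_zero _ (inv_ne_zero hz), one_div, inv_inv]

/-- The reduction map `ℙ¹(E((X))) → ℙ¹(E)`. -/
noncomputable def reduction (z : OnePoint (FractionRing (PowerSeries E))) : OnePoint E :=
  homogPoint (PowerSeries.constantCoeff (exists_homogPoint_algebraMap_eq z).choose)
    (PowerSeries.constantCoeff (exists_homogPoint_algebraMap_eq z).choose_spec.choose)

theorem algebraMap_ne_zero_or {x y : PowerSeries E}
    (hxy : PowerSeries.constantCoeff x ≠ 0 ∨ PowerSeries.constantCoeff y ≠ 0) :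
    algebraMap _ (FractionRing (PowerSeries E)) x ≠ 0 ∨
      algebraMap _ (FractionRing (PowerSeries E)) y ≠ 0 := by
  have h : ∀ {r : PowerSeries E}, PowerSeries.constantCoeff r ≠ 0 →
      algebraMap _ (FractionRing (PowerSeries E)) r ≠ 0 := fun hr h => by
    rw [FaithfulSMul.algebraMap_eq_zero_iff] at h
    exact hr (by rw [h, map_zero])
  exact hxy.imp h h

theorem reduction_homogPoint {x y : PowerSeries E}
    (hxy : PowerSeries.constantCoeff x ≠ 0 ∨ PowerSeries.constantCoeff y ≠ 0) :
    reduction (homogPoint (algebraMap _ (FractionRing (PowerSeries E)) x) (algebraMap _ _ y)) =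
      homogPoint (PowerSeries.constantCoeff x) (PowerSeries.constantCoeff y) := by
  have h := exists_homogPoint_algebraMap_eq
    (homogPoint (algebraMap _ (FractionRing (PowerSeries E)) x) (algebraMap _ _ y))
  have h1 := h.choose_spec.choose_spec.1
  have h2 := h.choose_spec.choose_spec.2
  rw [homogPoint_eq_iff (algebraMap_ne_zero_or h1) (algebraMap_ne_zero_or hxy), ← map_mul,
    ← map_mul] at h2
  have h3 := congrArg (PowerSeries.constantCoeff (R := E))
    (IsFractionRing.injective (PowerSeries E) (FractionRing (PowerSeries E)) h2)
  rw [map_mul, map_mul] at h3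
  exact (homogPoint_eq_iff h1 hxy).2 h3

theorem reduction_some (r : PowerSeries E) :
    reduction (OnePoint.some (algebraMap _ (FractionRing (PowerSeries E)) r)) =
      OnePoint.some (PowerSeries.constantCoeff r) := by
  have := reduction_homogPoint (x := r) (y := 1) (by simp)
  rwa [map_one, map_one, homogPoint_one_right, homogPoint_one_right] at this

theorem constantCoeff_homogEval (d : ℕ) (p : K[X]) (x y : PowerSeries E) :
    PowerSeries.constantCoeff (homogEval d p x y) =
      homogEval d p (PowerSeries.constantCoeff x) (PowerSeries.constantCoeff y) :=
  map_homogEval (residueHom K E) d p x y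

theorem algebraMap_homogEval (d : ℕ) (p : K[X]) (x y : PowerSeries E) :
    algebraMap _ (FractionRing (PowerSeries E)) (homogEval d p x y) =
      homogEval d p (algebraMap _ (FractionRing (PowerSeries E)) x) (algebraMap _ _ y) :=
  map_homogEval (IsScalarTower.toAlgHom K (PowerSeries E) (FractionRing (PowerSeries E))) d p x y

variable (f : RatFunc K)

/-- `f` has constant coefficients, so it has good reduction: normalized coordinates are sent to
normalized coordinates. -/
theorem reduction_ratMap (z : OnePoint (FractionRing (PowerSeries E))) :
    reduction (ratMap f _ z) = ratMap f E (reduction z) := by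
  obtain ⟨x, y, hxy, rfl⟩ := exists_homogPoint_algebraMap_eq z
  rw [ratMap_homogPoint f (algebraMap_ne_zero_or hxy), ← algebraMap_homogEval,
    ← algebraMap_homogEval, reduction_homogPoint, reduction_homogPoint hxy,
    ratMap_homogPoint f hxy, constantCoeff_homogEval, constantCoeff_homogEval]
  rw [constantCoeff_homogEval, constantCoeff_homogEval]
  exact homogEval_ne_zero f hxy

/-- Points of a fiber that are not critical lift along the reduction map. -/
theorem exists_reduction_eq (hd : 1 ≤ ratDegree f) {v : OnePoint (FractionRing (PowerSeries E))}
    {c : OnePoint E} (hc : ratMap f E c = reduction v) (hcrit : ¬ IsCriticalPoint f E c) :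
    ∃ z, ratMap f _ z = v ∧ reduction z = c := by
  have hp := natDegree_num_le_ratDegree f
  have hq := natDegree_denom_le_ratDegree f
  obtain ⟨a, b, hab, rfl⟩ := exists_homogPoint_algebraMap_eq v
  rw [reduction_homogPoint hab] at hc
  have key : ∀ x y : PowerSeries E,
      (PowerSeries.constantCoeff x ≠ 0 ∨ PowerSeries.constantCoeff y ≠ 0) →
      b * homogEval (ratDegree f) f.num x y - a * homogEval (ratDegree f) f.denom x y = 0 →
      ratMap f _ (homogPoint (algebraMap _ (FractionRing (PowerSeries E)) x) (algebraMap _ _ y)) =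
        homogPoint (algebraMap _ (FractionRing (PowerSeries E)) a) (algebraMap _ _ b) := by
    intro x y hxy h
    rw [ratMap_homogPoint_eq_iff f (algebraMap_ne_zero_or hxy) (algebraMap_ne_zero_or hab),
      ← algebraMap_homogEval, ← algebraMap_homogEval, ← map_mul, ← map_mul, sub_eq_zero.1 h]
  have hmap : ∀ p : K[X], (p.map (algebraMap K (PowerSeries E))).map PowerSeries.constantCoeff =
      p.map (algebraMap K E) := by
    intro p
    rw [Polynomial.map_map]
    exact congrArg (fun i => p.map i) (residueHom K E).comp_algebraMap
  cases c with
  | infty =>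
    rw [ratMap_infty_eq_iff f hab] at hc
    -- Near `∞` the coordinate is `1 / z`: Hensel's lemma is applied to the reflected equation at
    -- its root `0`.
    obtain ⟨r, hr, hr'⟩ := exists_isRoot_powerSeries
      (C b * (f.num.reflect (ratDegree f)).map (algebraMap K (PowerSeries E)) -
        C a * (f.denom.reflect (ratDegree f)).map (algebraMap K (PowerSeries E))) 0 (by
          rw [coeff_fiberPoly] at hc
          rw [← coeff_zero_eq_eval_zero]
          simpa [← reflect_map, hmap, coeff_reflect] using hc) (fun h => hcrit (by
          refine isCriticalPoint_infty_of_coeff f hab hd hc ?_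
          rw [← coeff_zero_eq_eval_zero] at h
          rw [coeff_fiberPoly]
          simpa [← reflect_map, hmap, coeff_derivative, coeff_reflect, revAt_le hd] using h))
    refine ⟨homogPoint (algebraMap _ _ 1) (algebraMap _ _ r), key 1 r (by simp) ?_, ?_⟩
    · rw [homogEval_one_left hp, homogEval_one_left hq]
      simpa [eval_map_algebraMap] using hr
    · rw [reduction_homogPoint (by simp), hr', homogPoint_zero_right]
  | coe c =>
    rw [ratMap_some_eq_iff f hab] at hc
    obtain ⟨r, hr, hr'⟩ := exists_isRoot_powerSeries
      (C b * f.num.map (algebraMap K (PowerSeries E)) -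
        C a * f.denom.map (algebraMap K (PowerSeries E))) c (by
          simpa [fiberPoly, hmap] using hc) (fun h => hcrit (by
          refine isCriticalPoint_of_aeval_eq_zero f hab (by rwa [coe_aeval_eq_eval]) ?_
          rw [coe_aeval_eq_eval]
          simpa [fiberPoly, hmap] using h))
    refine ⟨homogPoint (algebraMap _ _ r) (algebraMap _ _ 1), key r 1 (by simp) ?_, ?_⟩
    · rw [homogEval_one_right hp, homogEval_one_right hq]
      simpa [eval_map_algebraMap] using hr
    · rw [reduction_homogPoint (by simp), hr', map_one, homogPoint_one_right]

/-- The action of an automorphism of `E` on the coefficients of Laurent series. -/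
noncomputable def coeffAut (s : E ≃ₐ[K] E) :
    FractionRing (PowerSeries E) ≃ₐ[K] FractionRing (PowerSeries E) :=
  IsFractionRing.algEquivOfAlgEquiv <| AlgEquiv.ofAlgHom
    (PowerSeries.mapAlgHom (s : E →ₐ[K] E)) (PowerSeries.mapAlgHom (s.symm : E →ₐ[K] E))
    (AlgHom.ext fun r => PowerSeries.ext fun n => by simp [PowerSeries.mapAlgHom_apply])
    (AlgHom.ext fun r => PowerSeries.ext fun n => by simp [PowerSeries.mapAlgHom_apply])

theorem coeffAut_algebraMap (s : E ≃ₐ[K] E) (r : PowerSeries E) :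
    coeffAut s (algebraMap _ _ r) =
      algebraMap _ (FractionRing (PowerSeries E)) (r.map (s : E →+* E)) := by
  rw [coeffAut, IsFractionRing.algEquivOfAlgEquiv_algebraMap]
  rfl

theorem reduction_coeffAut (s : E ≃ₐ[K] E) (z : OnePoint (FractionRing (PowerSeries E))) :
    reduction (OnePoint.map (coeffAut s) z) = OnePoint.map s (reduction z) := by
  obtain ⟨x, y, hxy, rfl⟩ := exists_homogPoint_algebraMap_eq z
  have h : ∀ r : PowerSeries E,
      PowerSeries.constantCoeff (r.map (s : E →+* E)) = s (PowerSeries.constantCoeff r) :=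
    fun r => by
      rw [← PowerSeries.coeff_zero_eq_constantCoeff_apply,
        ← PowerSeries.coeff_zero_eq_constantCoeff_apply, PowerSeries.coeff_map]
      rfl
  have e1 := map_homogPoint (coeffAut s : FractionRing (PowerSeries E) →+* FractionRing (PowerSeries E))
    (algebraMap _ _ x) (algebraMap _ _ y)
  have e2 := map_homogPoint (s : E →+* E) (PowerSeries.constantCoeff x)
    (PowerSeries.constantCoeff y)
  simp only [RingHom.coe_coe, coeffAut_algebraMap] at e1 e2
  rw [reduction_homogPoint hxy, e1, e2, reduction_homogPoint, h, h]
  simpa [h] using hxy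

variable (E) in
/-- The power series `α + X`. -/
noncomputable def shiftedX (α : K) : PowerSeries E :=
  Polynomial.coeToPowerSeries.algHom E (X + C α)

theorem constantCoeff_shiftedX (α : K) :
    PowerSeries.constantCoeff (shiftedX E α) = algebraMap K E α := by
  simp [shiftedX]

theorem map_shiftedX (s : E ≃ₐ[K] E) (α : K) :
    (shiftedX E α).map (s : E →+* E) = shiftedX E α := by
  simp [shiftedX]

theorem transcendental_shiftedX (α : K) : Transcendental K (shiftedX E α) := by
  have h : Transcendental K (X + C α : K[X]) :=
    Polynomial.transcendental _ (by simp) (by simp)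
  refine (transcendental_iff_injective).2 fun p q hpq => ?_
  rw [shiftedX, aeval_algHom_apply, aeval_algHom_apply] at hpq
  refine (transcendental_iff_injective).1 h ?_
  have h1 := PowerSeries.map_injective (algebraMap K E) (algebraMap K E).injective hpq
  exact Polynomial.coe_injective K h1

end Reduction

/-! ### Comparison of the trees and Galois actions of `t` and `α`. -/

section Specialization

variable {K : Type u} [Field K] {f : RatFunc K}

/-- A fiber that already has the maximal number `d` of points gains none in a larger field. -/
theorem bijOn_fiber_of_algHom (hd : 1 ≤ ratDegree f) {L : Type v} [Field L] [Algebra K L]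
    {L' : Type w} [Field L'] [Algebra K L'] (φ : L →ₐ[K] L') {v : OnePoint L}
    (hv : {z | ratMap f L z = v}.ncard = ratDegree f) :
    Set.BijOn (OnePoint.map φ) {z | ratMap f L z = v}
      {z | ratMap f L' z = OnePoint.map φ v} := by
  have hmaps : Set.MapsTo (OnePoint.map φ) {z | ratMap f L z = v}
      {z | ratMap f L' z = OnePoint.map φ v} := fun z hz =>
    (ratMap_algHom f φ z).trans (congrArg (OnePoint.map φ) hz)
  have hinj : Function.Injective (OnePoint.map φ) := onePoint_map_injective φ.injective
  refine ⟨hmaps, hinj.injOn, ?_⟩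
  refine (Set.eq_of_subset_of_ncard_le hmaps.image_subset ?_ (fiber_finite f hd _)).ge
  rw [Set.ncard_image_of_injective _ hinj, hv]
  exact fiber_ncard_le f hd _

/-- Hensel's lemma gives surjectivity; the target has `d` points and the source at most `d`, which
forces injectivity. -/
theorem bijOn_fiber_reduction (hd : 1 ≤ ratDegree f) {α : K} (hα : ¬ IsStrictlyPostcritical f α)
    {E : Type v} [Field E] [IsSepClosed E] [Algebra K E] [Algebra.IsAlgebraic K E] {n : ℕ}
    {v : OnePoint (FractionRing (PowerSeries E))}
    (hv : (ratMap f E)^[n] (reduction v) = OnePoint.some (algebraMap K E α)) :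
    Set.BijOn reduction {z | ratMap f _ z = v} {z | ratMap f E z = reduction v} := by
  have hmaps : Set.MapsTo reduction {z | ratMap f _ z = v} {z | ratMap f E z = reduction v} :=
    fun z hz => (reduction_ratMap f z).symm.trans (congrArg reduction hz)
  have hsurj : Set.SurjOn reduction {z | ratMap f _ z = v} {z | ratMap f E z = reduction v} := by
    intro c hc
    refine exists_reduction_eq f hd hc
      (not_isCriticalPoint_of_not_isStrictlyPostcritical hα (Nat.le_add_left 1 n) ?_)
    rw [Function.iterate_succ_apply, show ratMap f E c = reduction v from hc, hv]
  refine ⟨hmaps, ?_, hsurj⟩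
  have hfin := fiber_finite f hd v
  refine Set.injOn_of_ncard_image_eq (le_antisymm (Set.ncard_image_le hfin) ?_) hfin
  rw [hsurj.image_eq_of_mapsTo hmaps, fiber_ncard_eq_of_not_isStrictlyPostcritical hd hα hv]
  exact fiber_ncard_le f hd v

theorem exists_algEquiv_of_normal {F : Type u} [Field F] {M : Type v} [Field M] [Algebra F M]
    [Normal F M] {A : Type w} [Field A] [Algebra F A] (j : M →ₐ[F] A) (S : A ≃ₐ[F] A) :
    ∃ σ : M ≃ₐ[F] M, ∀ x, j (σ x) = S (j x) := by
  let := j.toAlgebra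
  have : IsScalarTower F M A := IsScalarTower.of_algebraMap_eq fun x => (j.commutes x).symm
  exact ⟨S.restrictNormal M, S.restrictNormal_commutes M⟩

/-- An automorphism of `K^sep` over `K` comes, through the specialization of `t` to `α`, from an
automorphism of `K(t)^sep` over `K(t)`; the trees of preimages of `t` and `α` are identified by the
tree of preimages of `t = α + X` in the field of Laurent series over `K^sep`. -/
theorem finiteIndex_arithmeticGroup {Ksep : Type v} [Field Ksep] [Algebra K Ksep]
    [IsSepClosure K Ksep] {Ω : Type w} [Field Ω] [Algebra (RatFunc K) Ω]
    [IsSepClosure (RatFunc K) Ω] [Algebra K Ω] [IsScalarTower K (RatFunc K) Ω]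
    (hd : 2 ≤ ratDegree f) {α : K} (hα : ¬ IsStrictlyPostcritical f α)
    (hfin : (specializationGroup f Ksep α).FiniteIndex) :
    (arithmeticGroup f Ω).FiniteIndex := by
  have : IsSepClosed Ω := IsSepClosure.sep_closed (RatFunc K)
  have : IsSepClosed Ksep := IsSepClosure.sep_closed K
  have : Algebra.IsAlgebraic K Ksep := Algebra.IsSeparable.isAlgebraic _ _
  have hd1 : 1 ≤ ratDegree f := by omega
  let L := FractionRing (PowerSeries Ksep)
  let A := AlgebraicClosure L
  let tL : L := algebraMap _ L (shiftedX Ksep α)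
  have htL : Transcendental K tL :=
    (transcendental_algebraMap_iff (IsFractionRing.injective (PowerSeries Ksep) L)).2
      (transcendental_shiftedX α)
  let ι : L →ₐ[K] A := IsScalarTower.toAlgHom K L A
  -- The embedding of `K(t)` that sends `t` to `α + X`.
  let i : RatFunc K →ₐ[K] A := (ι.comp (IntermediateField.val _)).comp
    (RatFunc.algEquivOfTranscendental tL htL).toAlgHom
  have hiX : i RatFunc.X = ι tL :=
    congrArg ι (RatFunc.algEquivOfTranscendental_X tL htL)
  let := i.toRingHom.toAlgebra
  have : IsScalarTower K (RatFunc K) A :=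
    IsScalarTower.of_algebraMap_eq fun x => (i.commutes x).symm
  let j : Ω →ₐ[RatFunc K] A := IsSepClosed.lift
  let jK : Ω →ₐ[K] A := j.restrictScalars K
  have hjt : jK (genericPoint (K := K) Ω) = ι tL := (j.commutes RatFunc.X).trans hiX
  have hred : reduction (OnePoint.some tL) = OnePoint.some (algebraMap K Ksep α) := by
    rw [reduction_some, constantCoeff_shiftedX]
  have hscred : Function.Semiconj reduction (ratMap f L) (ratMap f Ksep) := reduction_ratMap f
  have hιc : Function.Semiconj (OnePoint.map ι) (ratMap f L) (ratMap f A) :=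
    fun z => (ratMap_algHom f ι z).symm
  have hjc : Function.Semiconj (OnePoint.map jK) (ratMap f Ω) (ratMap f A) :=
    fun z => (ratMap_algHom f jK z).symm
  have hvred : ∀ n v, (ratMap f L)^[n] v = OnePoint.some tL →
      (ratMap f Ksep)^[n] (reduction v) = OnePoint.some (algebraMap K Ksep α) := by
    intro n v hv
    rw [← (hscred.iterate_right n).eq, hv, hred]
  have bred : ∀ n, Set.BijOn reduction {z | (ratMap f L)^[n] z = OnePoint.some tL}
      {z | (ratMap f Ksep)^[n] z = OnePoint.some (algebraMap K Ksep α)} := fun n =>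
    hred ▸ bijOn_iterate_fiber hscred
      (fun n v hv => bijOn_fiber_reduction hd1 hα (hvred n v hv)) n
  have bι : ∀ n, Set.BijOn (OnePoint.map ι) {z | (ratMap f L)^[n] z = OnePoint.some tL}
      {z | (ratMap f A)^[n] z = OnePoint.some (ι tL)} := bijOn_iterate_fiber hιc fun n v hv => by
    refine bijOn_fiber_of_algHom hd1 ι ?_
    rw [← fiber_ncard_eq_of_not_isStrictlyPostcritical hd1 hα (hvred n v hv),
      ← (bijOn_fiber_reduction hd1 hα (hvred n v hv)).image_eq,
      (bijOn_fiber_reduction hd1 hα (hvred n v hv)).injOn.ncard_image]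
  have bj : ∀ n, Set.BijOn (OnePoint.map jK)
      {z | (ratMap f Ω)^[n] z = OnePoint.some (genericPoint (K := K) Ω)}
      {z | (ratMap f A)^[n] z = OnePoint.some (ι tL)} := fun n => by
    rw [← hjt]
    exact bijOn_iterate_fiber hjc (fun n v hv => bijOn_fiber_of_algHom hd1 jK
      (fiber_ncard_eq_of_transcendental f hd1
        (wronskian_ne_zero_of_not_isStrictlyPostcritical hd hα)
        transcendental_genericPoint hv)) n
  let e₁ := PreimageTree.equiv _ bj
  let e₂ := PreimageTree.equiv _ bι
  let e₃ := PreimageTree.equiv _ bred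
  have h₁ : IsTreeIso e₁ := fun v => ⟨rfl, PreimageTree.equiv_parent _ hjc bj v⟩
  have h₂ : IsTreeIso e₂ := fun v => ⟨rfl, PreimageTree.equiv_parent _ hιc bι v⟩
  have h₃ : IsTreeIso e₃ := fun v => ⟨rfl, PreimageTree.equiv_parent _ hscred bred v⟩
  refine finiteIndex_of_isTreeIso _ (h₁.trans (h₂.symm.trans h₃)) hfin ?_
  rintro _ ⟨s, rfl⟩
  -- An extension of the coefficientwise action of `s` to the algebraic closure. It fixes `α + X`,
  -- so it is an automorphism over `K(t)` and restricts to the normal extension `Ω`.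
  let S₀ : A ≃+* A := IsAlgClosure.equivOfEquiv A A (coeffAut s).toRingEquiv
  have hS₀ : ∀ x : L, S₀ (ι x) = ι (coeffAut s x) :=
    IsAlgClosure.equivOfEquiv_algebraMap A A (coeffAut s).toRingEquiv
  have hfix : coeffAut s tL = tL := by rw [coeffAut_algebraMap, map_shiftedX]
  have hS₀' : (S₀ : A →+* A).comp (algebraMap (RatFunc K) A) = algebraMap (RatFunc K) A := by
    refine ringHom_ratFunc_ext (fun x => ?_) ?_
    · rw [RingHom.comp_apply, ← IsScalarTower.algebraMap_apply, ← ι.commutes]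
      exact (hS₀ _).trans (congrArg ι ((coeffAut s).commutes x))
    · change S₀ (i RatFunc.X) = i RatFunc.X
      rw [hiX, hS₀, hfix]
  let S : A ≃ₐ[RatFunc K] A := AlgEquiv.ofRingEquiv (f := S₀) fun r => DFunLike.congr_fun hS₀' r
  obtain ⟨σ, hσ⟩ := exists_algEquiv_of_normal j S
  refine ⟨genericRep f Ω σ, ⟨σ, rfl⟩, fun v => ?_⟩
  -- `w` is the vertex over `L` corresponding to `v`; equivariance is checked there, where reduction
  -- commutes with the action on coefficients.
  obtain ⟨w, hw⟩ := e₂.surjective (e₁ v)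
  have hwv : OnePoint.map ι w.2.1 = OnePoint.map jK v.2.1 :=
    congrArg (fun z : PreimageTree f (ι tL) => z.2.1) hw
  have hwv1 : w.1 = v.1 := congrArg (fun z : PreimageTree f (ι tL) => z.1) hw
  let w' : PreimageTree f tL := ⟨w.1, OnePoint.map (coeffAut s) w.2.1, by
    rw [ratMap_iterate_map, w.2.2, OnePoint.map_some, hfix]⟩
  have hw' : e₂ w' = e₁ ((genericRep f Ω σ : Equiv.Perm _) v) := by
    refine PreimageTree.ext hwv1 ?_
    change OnePoint.map ι (OnePoint.map (coeffAut s) w.2.1) =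
      OnePoint.map jK (OnePoint.map σ v.2.1)
    have c1 : OnePoint.map ι (OnePoint.map (coeffAut s) w.2.1) =
        OnePoint.map S₀ (OnePoint.map ι w.2.1) := by
      cases w.2.1 with
      | infty => rfl
      | coe x => exact congrArg OnePoint.some (hS₀ x).symm
    have c2 : OnePoint.map jK (OnePoint.map σ v.2.1) =
        OnePoint.map S₀ (OnePoint.map jK v.2.1) := by
      cases v.2.1 with
      | infty => rfl
      | coe x => exact congrArg OnePoint.some (hσ x)
    rw [c1, c2, hwv]
  simp only [Equiv.trans_apply]
  rw [← hw, ← hw', e₂.symm_apply_apply, e₂.symm_apply_apply]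
  exact PreimageTree.ext rfl (reduction_coeffAut s w.2.1)

end Specialization

end Arboreal

theorem corollary1 {K : Type*} [Field K]
    {Ksep : Type*} [Field Ksep] [Algebra K Ksep] [IsSepClosure K Ksep]
    {Ω : Type*} [Field Ω] [Algebra (RatFunc K) Ω] [IsSepClosure (RatFunc K) Ω]
    [Algebra K Ω] [IsScalarTower K (RatFunc K) Ω]
    (f : RatFunc K) (hd : 2 ≤ Arboreal.ratDegree f)
    (α : K) (hα : ¬ Arboreal.IsStrictlyPostcritical f α)
    (hfin : (Arboreal.specializationGroup f Ksep α).FiniteIndex) :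
    Arboreal.geometricGroup f Ω = Arboreal.arithmeticGroup f Ω ∧
      Arboreal.arithmeticGroup f Ω = ⊤ := by
  have h : Arboreal.geometricGroup f Ω = ⊤ :=
    Arboreal.geometricGroup_eq_top_of_finiteIndex hd
      (Arboreal.wronskian_ne_zero_of_not_isStrictlyPostcritical hd hα)
      (Arboreal.finiteIndex_arithmeticGroup hd hα hfin)
  have h' : Arboreal.arithmeticGroup f Ω = ⊤ :=
    top_le_iff.1 (h ▸ Arboreal.geometricGroup_le_arithmeticGroup)
  exact ⟨h.trans h'.symm, h'⟩
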